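/- For a positive integer $m$, let $\|m\|$ be the least number of $1$'s needed to write $m$ using addition, multiplication and parentheses, and let $\delta(m)=\|m\|-3\log_3 m$ be its defect. Call $m$ stable if $\|3^k m\|=3k+\|m\|$ for all $k\ge 0$. For every positive integer $m$ there is some $k\geq 0$ with $3^k m$ stable; with such a $k$ put $\delta_{\mathrm{st}}(m)=\delta(3^k m)$ and $\|m\|_{\mathrm{st}}=\|3^k m\|-3k$, which do not depend on the choice of $k$. Let $\mathscr{D}_{\mathrm{st}}=\{\delta(m): m \text{ stable}\}$ and, for a congruence class $u$ modulo $3$, let $\mathscr{D}^u_{\mathrm{st}}=\mathscr{D}_{\mathrm{st}}\cap\{\delta(m): m>1,\ \|m\|\equiv u \pmod 3\}$. These sets of real numbers are well-ordered. For a well-ordered set $S$ of reals and an ordinal $\alpha$, $S[\alpha]$ denotes the $\alpha$-th element of $S$, counting from $0$. **Theorem.** Let $n$ be a positive integer not divisible by $3$, let $\|n\|_{\mathrm{st}}\equiv u\pmod 3$, and let $$E=\{\delta_{\mathrm{st}}(b(a3^k+1)) : k\ge 0,\ ab=n,\ \|n\|_{\mathrm{st}}=\|a\|_{\mathrm{st}}+\|b\|_{\mathrm{st}}\}.$$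 (1) There is an ordinal $\alpha$ with $\delta_{\mathrm{st}}(n)=\mathscr{D}^u_{\mathrm{st}}[\alpha]$. For this $\alpha$, the elements $\mathscr{D}^{u+1}_{\mathrm{st}}[\omega\alpha+k]$ exist for all integers $k\ge 0$, and $$\{\mathscr{D}^{u+1}_{\mathrm{st}}[\omega\alpha+k] : k\in\mathbb{Z}_{\ge 0}\}=\mathscr{D}^{u+1}_{\mathrm{st}}\cap\bigl[\mathscr{D}^{u+1}_{\mathrm{st}}[\omega\alpha],\ \delta_{\mathrm{st}}(n)+1\bigr),$$ and this set has finite symmetric difference with $E$. (2) Likewise, there is an ordinal $\alpha$ (in general different from the one in (1)) with $\delta_{\mathrm{st}}(n)=\mathscr{D}_{\mathrm{st}}[\alpha]$. For this $\alpha$, the elements $\mathscr{D}_{\mathrm{st}}[\omega\alpha+k]$ exist for all integers $k\ge 0$, and $$\{\mathscr{D}_{\mathrm{st}}[\omega\alpha+k] : k\in\mathbb{Z}_{\ge 0}\}=\mathscr{D}_{\mathrm{st}}\cap\bigl[\mathscr{D}_{\mathrm{st}}[\omega\alpha],\ \delta_{\mathrm{st}}(n)+1\bigr),$$ and this set has finite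 symmetric difference with $E$. -/

import Mathlib

open scoped Ordinal

namespace IntegerComplexity

/-- Expressions built from the constant `1` by addition and multiplication. -/
inductive OnesExpr : Type
  | one : OnesExpr
  | add : OnesExpr → OnesExpr → OnesExpr
  | mul : OnesExpr → OnesExpr → OnesExpr

/-- The value of an expression. -/
def OnesExpr.eval : OnesExpr → ℕ
  | .one => 1
  | .add e f => e.eval + f.eval
  | .mul e f => e.eval * f.eval

/-- The number of `1`'s occurring in an expression. -/
def OnesExpr.ones : OnesExpr → ℕ
  | .one => 1
  | .add e f => e.ones + f.ones
  | .mul e f => e.ones + f.ones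

/-- The complexity `‖n‖` of a positive integer `n`: the least number of `1`'s in an expression
with value `n`. (No expression has value `0`; the value at `n = 0` is never used.) -/
noncomputable def cpx (n : ℕ) : ℕ :=
  sInf {c : ℕ | ∃ e : OnesExpr, e.eval = n ∧ e.ones = c}

/-- The number `n` is stable if `‖3 ^ k * n‖ = 3 * k + ‖n‖` for all `k ≥ 0`. -/
def IsStable (n : ℕ) : Prop :=
  ∀ k : ℕ, cpx (3 ^ k * n) = 3 * k + cpx n

/-- The defect `δ(n) = ‖n‖ - 3 log₃ n`. -/
noncomputable def defect (n : ℕ) : ℝ :=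
  (cpx n : ℝ) - 3 * Real.logb 3 (n : ℝ)

/-- `K(n)`, the smallest `k` such that `3 ^ k * n` is stable. Such a `k` exists for every
positive `n`: see `isStable_stabIndex`. -/
noncomputable def stabIndex (n : ℕ) : ℕ :=
  sInf {k : ℕ | IsStable (3 ^ k * n)}

/-- The stable defect `δ_st(n) = δ(3 ^ k * n)`, where `3 ^ k * n` is stable. -/
noncomputable def stDefect (n : ℕ) : ℝ :=
  defect (3 ^ stabIndex n * n)

/-- The stable complexity `‖n‖_st = ‖3 ^ k * n‖ - 3 * k`, where `3 ^ k * n` is stable. -/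
noncomputable def stCpx (n : ℕ) : ℤ :=
  (cpx (3 ^ stabIndex n * n) : ℤ) - 3 * (stabIndex n : ℤ)

/-- `𝒟_st`, the set of defects of stable numbers. -/
def stDefects : Set ℝ :=
  {x : ℝ | ∃ n : ℕ, 0 < n ∧ IsStable n ∧ x = defect n}

/-- `𝒟ᵘ`, the set of defects of the numbers `n > 1` with `‖n‖ ≡ u (mod 3)`. -/
def defectsMod (u : ZMod 3) : Set ℝ :=
  {x : ℝ | ∃ n : ℕ, 1 < n ∧ (cpx n : ZMod 3) = u ∧ x = defect n}

/-- `𝒟ᵘ_st = 𝒟ᵘ ∩ 𝒟_st`. -/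
def stDefectsMod (u : ZMod 3) : Set ℝ :=
  defectsMod u ∩ stDefects

/-- `x = S[α]`: the set `S` is well-ordered, and `x` is its `α`-th element, counting from `0`;
that is, the elements of `S` below `x` have order type `α`. -/
def IsNth (S : Set ℝ) (α : Ordinal.{0}) (x : ℝ) : Prop :=
  S.IsWF ∧ x ∈ S ∧ Nonempty (Set.Iio α ≃o ↥(S ∩ Set.Iio x))

/-- The set `{S[ω * α + k] : k ≥ 0}`. -/
def omegaBlock (S : Set ℝ) (α : Ordinal.{0}) : Set ℝ :=
  {x : ℝ | ∃ k : ℕ, IsNth S (ω * α + (k : Ordinal.{0})) x}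

/-- The set of all `δ_st(b(a3ᵏ + 1))` with `k ≥ 0`, `ab = n` and `‖n‖_st = ‖a‖_st + ‖b‖_st`. -/
def factorDefects (n : ℕ) : Set ℝ :=
  {x : ℝ | ∃ a b k : ℕ, a * b = n ∧ stCpx n = stCpx a + stCpx b ∧
    x = stDefect (b * (a * 3 ^ k + 1))}

theorem OnesExpr.eval_pos (e : OnesExpr) : 0 < e.eval := by
  induction e with
  | one => simp [OnesExpr.eval]
  | add e f he hf => simp only [OnesExpr.eval]; omega
  | mul e f he hf => simp only [OnesExpr.eval]; positivity

theorem OnesExpr.ones_pos (e : OnesExpr) : 0 < e.ones := by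
  induction e with
  | one => simp [OnesExpr.ones]
  | add e f he hf => simp only [OnesExpr.ones]; omega
  | mul e f he hf => simp only [OnesExpr.ones]; omega

theorem one_add_cube_le {y t : ℕ} (hy : 0 < y) (ht : 0 < t) (h : y ^ 3 ≤ 3 ^ t) :
    (1 + y) ^ 3 ≤ 3 ^ (1 + t) := by
  rw [pow_add, pow_one]
  rcases Nat.lt_or_ge y 3 with h3 | h3
  · interval_cases y
    · have : 3 ^ 1 ≤ 3 ^ t := Nat.pow_le_pow_right (by norm_num) ht
      omega
    · have h2 : 2 ≤ t := by
        by_contra hc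
        have : t = 1 := by omega
        subst this
        norm_num at h
      have : 3 ^ 2 ≤ 3 ^ t := Nat.pow_le_pow_right (by norm_num) h2
      omega
  · have : (1 + y) ^ 3 ≤ 3 * y ^ 3 := by
      obtain ⟨z, rfl⟩ := Nat.exists_eq_add_of_le h3
      ring_nf
      nlinarith [sq_nonneg (z : ℤ), Nat.zero_le (z ^ 2), Nat.zero_le (z ^ 3)]
    omega

theorem OnesExpr.eval_cube_le (e : OnesExpr) : e.eval ^ 3 ≤ 3 ^ e.ones := by
  induction e with
  | one => simp [OnesExpr.eval, OnesExpr.ones]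
  | add e f he hf =>
    simp only [OnesExpr.eval, OnesExpr.ones]
    have h1 := e.eval_pos
    have h2 := f.eval_pos
    have h3 := e.ones_pos
    have h4 := f.ones_pos
    rcases Nat.lt_or_ge e.eval 2 with h | h
    · have : e.eval = 1 := by omega
      rw [this]
      refine (one_add_cube_le h2 h4 hf).trans (Nat.pow_le_pow_right (by norm_num) (by omega))
    rcases Nat.lt_or_ge f.eval 2 with h' | h'
    · have : f.eval = 1 := by omega
      rw [this, add_comm]
      refine (one_add_cube_le h1 h3 he).trans (Nat.pow_le_pow_right (by norm_num) (by omega))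
    · calc (e.eval + f.eval) ^ 3 ≤ (e.eval * f.eval) ^ 3 :=
            Nat.pow_le_pow_left (by nlinarith) 3
        _ = e.eval ^ 3 * f.eval ^ 3 := by ring
        _ ≤ 3 ^ e.ones * 3 ^ f.ones := Nat.mul_le_mul he hf
        _ = 3 ^ (e.ones + f.ones) := by rw [pow_add]
  | mul e f he hf =>
    simp only [OnesExpr.eval, OnesExpr.ones]
    calc (e.eval * f.eval) ^ 3 = e.eval ^ 3 * f.eval ^ 3 := by ring
      _ ≤ 3 ^ e.ones * 3 ^ f.ones := Nat.mul_le_mul he hf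
      _ = 3 ^ (e.ones + f.ones) := by rw [pow_add]

theorem OnesExpr.exists_eval_eq {n : ℕ} (hn : 0 < n) : ∃ e : OnesExpr, e.eval = n := by
  induction n, hn using Nat.le_induction with
  | base => exact ⟨.one, rfl⟩
  | succ n _ ih =>
    obtain ⟨e, he⟩ := ih
    exact ⟨.add e .one, by simp [OnesExpr.eval, he]⟩

theorem exists_expr_cpx {n : ℕ} (hn : 0 < n) :
    ∃ e : OnesExpr, e.eval = n ∧ e.ones = cpx n := by
  obtain ⟨e, he⟩ := OnesExpr.exists_eval_eq hn
  exact Nat.sInf_mem (s := {c : ℕ | ∃ e : OnesExpr, e.eval = n ∧ e.ones = c}) ⟨_, e, he, rfl⟩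

theorem cpx_eval_le (e : OnesExpr) : cpx e.eval ≤ e.ones :=
  Nat.sInf_le ⟨e, rfl, rfl⟩

theorem cpx_three_mul_le {n : ℕ} (hn : 0 < n) : cpx (3 * n) ≤ 3 + cpx n := by
  obtain ⟨e, rfl, hc⟩ := exists_expr_cpx hn
  rw [← hc]
  exact cpx_eval_le (.mul (.add (.add .one .one) .one) e)

theorem three_mul_le_cpx {n : ℕ} (hn : 0 < n) (k : ℕ) : 3 * k ≤ cpx (3 ^ k * n) := by
  have hpos : 0 < 3 ^ k * n := by positivity
  obtain ⟨e, he, hc⟩ := exists_expr_cpx hpos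
  have h := e.eval_cube_le
  rw [he, hc] at h
  have h2 : (3 : ℕ) ^ (3 * k) ≤ 3 ^ cpx (3 ^ k * n) := by
    refine le_trans ?_ h
    rw [mul_comm 3 k, pow_mul]
    exact Nat.pow_le_pow_left (Nat.le_mul_of_pos_right _ hn) 3
  exact (Nat.pow_le_pow_iff_right (by norm_num)).1 h2

/-- Every positive integer becomes stable after multiplication by some power of `3`, so that
`stabIndex`, `stDefect` and `stCpx` have their intended meaning. -/
theorem isStable_stabIndex {n : ℕ} (hn : 0 < n) : IsStable (3 ^ stabIndex n * n) := by
  refine Nat.sInf_mem (s := {k : ℕ | IsStable (3 ^ k * n)}) ?_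
  let g : ℕ → ℕ := fun k => cpx (3 ^ k * n) - 3 * k
  have hg : Antitone g := by
    refine antitone_nat_of_succ_le fun k => ?_
    have h := cpx_three_mul_le (n := 3 ^ k * n) (by positivity)
    have h' : 3 ^ (k + 1) * n = 3 * (3 ^ k * n) := by ring
    simp only [g, h']
    omega
  obtain ⟨k₀, hk₀⟩ : ∃ k₀, ∀ j, g k₀ ≤ g j := by
    obtain ⟨k₀, h⟩ := Nat.sInf_mem (Set.range_nonempty g)
    exact ⟨k₀, fun j => h ▸ Nat.sInf_le ⟨j, rfl⟩⟩
  refine ⟨k₀, fun k => ?_⟩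
  have h1 : g (k + k₀) = g k₀ := le_antisymm (hg (by omega)) (hk₀ _)
  have h2 := three_mul_le_cpx hn (k + k₀)
  have h3 := three_mul_le_cpx hn k₀
  have h4 : 3 ^ k * (3 ^ k₀ * n) = 3 ^ (k + k₀) * n := by ring
  simp only [g] at h1
  rw [h4]
  omega

end IntegerComplexity

/-! The core is a description of the numbers of bounded defect. Apart from small cases, an optimal
sum has defect at least `defectGap` above that of its larger summand, and a factor that is not a
power of 3 has defect at least `defectGap`; so one can induct on the number of gaps. The outcome
(`exists_seqForm_of_defect_lt`): a sequence of bounded defect has a subsequence that, up to powers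
of 3, is constant, or is b(a3^k+1) with k → ∞, or is asymptotic from above to m3^K while spending at
least two 1's beyond ‖m‖_st + 3K.

In each form the defects converge without exceeding their limit, so stable defects never decrease
strictly forever. The limit of a strictly increasing sequence of them is δ_st(m)+j with j ≥ 1, and j
= 1 forces the form b(a3^k+1) with ab = m an optimal factorization
(`exists_of_strictMono_stDefect`). Moreover δ_st(m) modulo 1 determines m up to powers of 3. Hence
no δ_st(m)-d with d ≥ 0 is such a limit, and this in turn shows that an optimal factorization ab
really yields stable defects of b(a3^k+1) increasing to δ_st(ab)+1.

Let S be the stable defects with class in U, and T those with class in U+1. The block of y in S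
consists of the t in T below y+1 with t ≥ z+1 for all z < y in S (`shiftBlock`). The block of
δ_st(n) is infinite because of the numbers n3^k+1. It accumulates only at y+1: for a limit L < y+1,
the number L-1 lies in the closure of S, which produces z < y in S with z+1 above an element of the
block. So the blocks have type ω, and the block of S[α] is {T[ωα+k]}. Infinitely many elements of
the block outside E would tend to δ_st(n)+1, which forces j = 1 and puts one of them in E;
conversely, each of the finitely many factorizations in E leaves the block for only finitely many k.
-/

namespace IntegerComplexity

/-! ### Elementary bounds for complexity -/

theorem cpx_mul_le {a b : ℕ} (ha : 0 < a) (hb : 0 < b) : cpx (a * b) ≤ cpx a + cpx b := by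
  obtain ⟨e, rfl, he⟩ := exists_expr_cpx ha
  obtain ⟨f, rfl, hf⟩ := exists_expr_cpx hb
  rw [← he, ← hf]
  exact cpx_eval_le (.mul e f)

theorem cpx_add_le {a b : ℕ} (ha : 0 < a) (hb : 0 < b) : cpx (a + b) ≤ cpx a + cpx b := by
  obtain ⟨e, rfl, he⟩ := exists_expr_cpx ha
  obtain ⟨f, rfl, hf⟩ := exists_expr_cpx hb
  rw [← he, ← hf]
  exact cpx_eval_le (.add e f)

theorem cpx_pos {n : ℕ} (hn : 0 < n) : 0 < cpx n := by
  obtain ⟨e, -, he⟩ := exists_expr_cpx hn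
  exact he ▸ e.ones_pos

theorem cpx_one : cpx 1 = 1 :=
  le_antisymm (cpx_eval_le .one) (cpx_pos one_pos)

theorem cube_le_three_pow_cpx {n : ℕ} (hn : 0 < n) : n ^ 3 ≤ 3 ^ cpx n := by
  obtain ⟨e, rfl, he⟩ := exists_expr_cpx hn
  exact he ▸ e.eval_cube_le

theorem two_le_cpx {n : ℕ} (hn : 1 < n) : 2 ≤ cpx n := by
  by_contra h
  have h1 := cube_le_three_pow_cpx (zero_lt_one.trans hn)
  have h2 : 3 ^ cpx n ≤ 3 ^ 1 := Nat.pow_le_pow_right (by norm_num) (by omega)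
  have h3 : 2 ^ 3 ≤ n ^ 3 := Nat.pow_le_pow_left hn 3
  omega

theorem cpx_three_pow {k : ℕ} (hk : 0 < k) : cpx (3 ^ k) = 3 * k := by
  refine le_antisymm ?_ (by simpa using three_mul_le_cpx one_pos k)
  induction k, hk using Nat.le_induction with
  | base => exact cpx_eval_le (.add (.add .one .one) .one)
  | succ k hk ih =>
    have := cpx_three_mul_le (n := 3 ^ k) (by positivity)
    rw [pow_succ']
    omega

theorem cpx_three_pow_mul_le {n : ℕ} (hn : 0 < n) (k : ℕ) : cpx (3 ^ k * n) ≤ 3 * k + cpx n := by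
  induction k with
  | zero => simp
  | succ k ih =>
    have := cpx_three_mul_le (n := 3 ^ k * n) (by positivity)
    rw [pow_succ', mul_assoc]
    omega

/-- A number greater than `1` is a sum or a nontrivial product of numbers whose complexities add
up to its complexity. -/
theorem exists_optimal_split {n : ℕ} (hn : 1 < n) :
    (∃ a c, 0 < c ∧ c ≤ a ∧ n = a + c ∧ cpx n = cpx a + cpx c) ∨
      ∃ a b, 1 < a ∧ 1 < b ∧ n = a * b ∧ cpx n = cpx a + cpx b := by
  obtain ⟨e, rfl, he⟩ := exists_expr_cpx (zero_lt_one.trans hn)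
  cases e with
  | one => simp [OnesExpr.eval] at hn
  | add e f =>
    left
    simp only [OnesExpr.eval, OnesExpr.ones] at *
    have h1 := cpx_add_le e.eval_pos f.eval_pos
    have h2 := cpx_eval_le e
    have h3 := cpx_eval_le f
    rcases le_total f.eval e.eval with h | h
    · exact ⟨_, _, f.eval_pos, h, rfl, by omega⟩
    · exact ⟨_, _, e.eval_pos, h, add_comm _ _, by omega⟩
  | mul e f =>
    right
    simp only [OnesExpr.eval, OnesExpr.ones] at *
    have h1 := cpx_mul_le e.eval_pos f.eval_pos
    have h2 := cpx_eval_le e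
    have h3 := cpx_eval_le f
    have h4 := e.eval_pos
    have h5 := f.eval_pos
    have h6 := e.ones_pos
    have h7 := f.ones_pos
    refine ⟨_, _, ?_, ?_, rfl, by omega⟩
    · by_contra h
      have : e.eval = 1 := by omega
      rw [this, one_mul] at he
      omega
    · by_contra h
      have : f.eval = 1 := by omega
      rw [this, mul_one] at he
      omega

/-! ### Defects and the splitting of numbers of bounded defect -/

theorem logb_three_natCast_mul {a b : ℕ} (ha : 0 < a) (hb : 0 < b) :
    Real.logb 3 ((a * b : ℕ) : ℝ) = Real.logb 3 a + Real.logb 3 b := by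
  rw [Nat.cast_mul, Real.logb_mul (by positivity) (by positivity)]

theorem logb_three_pow (k : ℕ) : Real.logb 3 ((3 ^ k : ℕ) : ℝ) = k := by
  rw [Nat.cast_pow, Real.logb_pow]
  norm_num

theorem defect_nonneg {n : ℕ} (hn : 0 < n) : 0 ≤ defect n := by
  have h : ((n ^ 3 : ℕ) : ℝ) ≤ ((3 ^ cpx n : ℕ) : ℝ) := by
    exact_mod_cast cube_le_three_pow_cpx hn
  have h2 := Real.logb_le_logb_of_le (b := 3) (by norm_num) (by positivity) h
  rw [logb_three_pow, Nat.cast_pow, Real.logb_pow] at h2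
  push_cast at h2
  unfold defect
  linarith

theorem defect_mul {a b : ℕ} (ha : 0 < a) (hb : 0 < b) (h : cpx (a * b) = cpx a + cpx b) :
    defect (a * b) = defect a + defect b := by
  unfold defect
  rw [logb_three_natCast_mul ha hb, h]
  push_cast
  ring

/-- The defect of `2`, which is the least positive defect. -/
noncomputable def defectGap : ℝ := 2 - 3 * Real.logb 3 2

theorem defectGap_pos : 0 < defectGap := by
  have h := Real.logb_lt_logb (b := 3) (x := 2 ^ 3) (y := 3 ^ 2) (by norm_num) (by norm_num)
    (by norm_num)
  rw [Real.logb_pow, Real.logb_pow, Real.logb_self_eq_one (by norm_num)] at h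
  unfold defectGap
  push_cast at h
  linarith

theorem logb_add_le_logb_two {a c : ℕ} (hc : 0 < c) (hca : c ≤ a) :
    Real.logb 3 ((a + c : ℕ) : ℝ) ≤ Real.logb 3 a + Real.logb 3 2 := by
  have ha : (0 : ℝ) < a := by exact_mod_cast hc.trans_le hca
  rw [← Real.logb_mul ha.ne' (by norm_num)]
  have : (c : ℝ) ≤ a := by exact_mod_cast hca
  refine Real.logb_le_logb_of_le (by norm_num) (by positivity) ?_
  push_cast
  linarith

/-- If c > 1, then ‖c‖ ≥ 2 while the logarithm grows by at most log₃ 2. If c = 1, then a ≥ 3 gives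
a+1 ≤ 4a/3, and the defect even grows by two gaps. -/
theorem defect_add_gap_le {a c : ℕ} (ha : 3 ≤ a) (hc : 0 < c) (hca : c ≤ a)
    (h : cpx (a + c) = cpx a + cpx c) : defect a + defectGap ≤ defect (a + c) := by
  have hpos := defectGap_pos
  have ha0 : (0 : ℝ) < a := by positivity
  unfold defect
  unfold defectGap at *
  rw [h]
  push_cast
  rcases Nat.lt_or_ge 1 c with h1 | h1
  · have h2 : (2 : ℝ) ≤ cpx c := by exact_mod_cast two_le_cpx h1
    have h3 := logb_add_le_logb_two hc hca
    push_cast at h3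
    linarith
  · obtain rfl : c = 1 := by omega
    have h3 : Real.logb 3 ((a : ℝ) + 1) ≤ Real.logb 3 ((a : ℝ) * (2 ^ 2 / 3)) := by
      refine Real.logb_le_logb_of_le (by norm_num) (by positivity) ?_
      have : (3 : ℝ) ≤ a := by exact_mod_cast ha
      linarith
    rw [Real.logb_mul ha0.ne' (by norm_num), Real.logb_div (by norm_num) (by norm_num),
      Real.logb_pow, Real.logb_self_eq_one (by norm_num)] at h3
    rw [cpx_one]
    push_cast at *
    linarith

theorem defect_two : defect 2 = defectGap := by
  have h : cpx 2 = 2 :=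
    le_antisymm (cpx_eval_le (.add .one .one)) (two_le_cpx (by norm_num))
  simp [defect, defectGap, h]

/-- A number whose defect is below `δ(2)` is a power of `3`. -/
theorem exists_eq_three_pow_of_defect_lt {n : ℕ} (hn : 0 < n) (h : defect n < defectGap) :
    ∃ j, n = 3 ^ j := by
  induction n using Nat.strong_induction_on with
  | _ n ih =>
  rcases Nat.lt_or_ge 1 n with h1 | h1
  swap
  · exact ⟨0, by simp; omega⟩
  rcases exists_optimal_split h1 with ⟨a, c, hc, hca, rfl, h2⟩ | ⟨a, b, ha, hb, rfl, h2⟩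
  · rcases Nat.lt_or_ge a 3 with h3 | h3
    · rcases Nat.lt_or_ge (a + c) 3 with h4 | h4
      · have : a + c = 2 := by omega
        rw [this, defect_two] at h
        exact absurd h (lt_irrefl _)
      · rcases Nat.lt_or_ge 3 (a + c) with h5 | h5
        · obtain ⟨rfl, rfl⟩ : a = 2 ∧ c = 2 := by omega
          have h6 := defect_mul (a := 2) (b := 2) (by norm_num) (by norm_num) h2
          have h7 : defect (2 + 2) = defect (2 * 2) := rfl
          rw [h7, h6, defect_two] at h
          linarith [defectGap_pos]
        · exact ⟨1, by omega⟩
    · have := defect_add_gap_le h3 hc hca h2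
      have := defect_nonneg (n := a) (by omega)
      linarith
  · have h3 := defect_mul (by omega) (by omega) h2
    have h4 := defect_nonneg (n := a) (by omega)
    have h5 := defect_nonneg (n := b) (by omega)
    obtain ⟨i, hi⟩ := ih a (by nlinarith) (by omega) (by linarith)
    obtain ⟨j, hj⟩ := ih b (by nlinarith) (by omega) (by linarith)
    exact ⟨i + j, by rw [hi, hj, pow_add]⟩

/-- In an optimal sum, the smaller summand is bounded in terms of the defect. -/
theorem exists_summand_bound (r : ℝ) : ∃ B : ℕ, ∀ a c : ℕ, 0 < c → c ≤ a →
    cpx (a + c) = cpx a + cpx c → defect (a + c) < r → c ≤ B := by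
  -- Since ‖a‖ ≥ 3 log₃ a and ‖c‖ ≥ 3 log₃ c, the defect of a+c is at least 3 log₃ c - 3 log₃ 2.
  refine ⟨⌈(3 : ℝ) ^ (r / 3 + Real.logb 3 2)⌉₊, fun a c hc hca h hr => ?_⟩
  have h1 := defect_nonneg (hc.trans_le hca)
  have h2 := defect_nonneg hc
  have h3 := logb_add_le_logb_two hc hca
  have h4 : (c : ℝ) < 3 ^ (r / 3 + Real.logb 3 2) := by
    rw [← Real.logb_lt_iff_lt_rpow (by norm_num) (by exact_mod_cast hc)]
    unfold defect at *
    rw [h] at hr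
    push_cast at *
    linarith
  exact_mod_cast h4.le.trans (Nat.le_ceil _)

/-- Numbers of bounded defect are obtained, up to a power of `3`, from finitely many numbers and
from numbers of smaller defect by multiplication and by addition of bounded numbers. -/
theorem exists_bounded_split (N : ℕ) : ∃ B : ℕ, ∀ n : ℕ, 0 < n →
    defect n < (N + 1) * defectGap →
    ∃ k m, 0 < m ∧ n = 3 ^ k * m ∧ cpx n = 3 * k + cpx m ∧
      (m ≤ 4 ∨
        (∃ u v, 0 < u ∧ 0 < v ∧ m = u * v ∧ cpx m = cpx u + cpx v ∧
          defect u < N * defectGap ∧ defect v < N * defectGap) ∨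
        ∃ a c, 0 < a ∧ 0 < c ∧ c ≤ B ∧ m = a + c ∧ cpx m = cpx a + cpx c ∧
          defect a < N * defectGap) := by
  obtain ⟨B, hB⟩ := exists_summand_bound ((N + 1) * defectGap)
  refine ⟨B, fun n => ?_⟩
  -- A factor that is a power of 3 does not lower the defect of its cofactor by a gap; it is
  -- absorbed into `3 ^ k` instead.
  have key : ∀ a b, 0 < a → 1 < b → (∃ j, b = 3 ^ j) → cpx (a * b) = cpx a + cpx b →
      (∃ k m, 0 < m ∧ a = 3 ^ k * m ∧ cpx a = 3 * k + cpx m ∧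
      (m ≤ 4 ∨
        (∃ u v, 0 < u ∧ 0 < v ∧ m = u * v ∧ cpx m = cpx u + cpx v ∧
          defect u < N * defectGap ∧ defect v < N * defectGap) ∨
        ∃ a c, 0 < a ∧ 0 < c ∧ c ≤ B ∧ m = a + c ∧ cpx m = cpx a + cpx c ∧
          defect a < N * defectGap)) →
      ∃ k m, 0 < m ∧ a * b = 3 ^ k * m ∧ cpx (a * b) = 3 * k + cpx m ∧
      (m ≤ 4 ∨
        (∃ u v, 0 < u ∧ 0 < v ∧ m = u * v ∧ cpx m = cpx u + cpx v ∧
          defect u < N * defectGap ∧ defect v < N * defectGap) ∨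
        ∃ a c, 0 < a ∧ 0 < c ∧ c ≤ B ∧ m = a + c ∧ cpx m = cpx a + cpx c ∧
          defect a < N * defectGap) := by
    rintro a b ha hb ⟨j, rfl⟩ h ⟨k, m, hm, h1, h2, h3⟩
    have hj : 0 < j := by
      rcases Nat.eq_zero_or_pos j with rfl | hj
      · simp at hb
      · exact hj
    refine ⟨k + j, m, hm, ?_, ?_, h3⟩
    · rw [h1]; ring
    · rw [h, cpx_three_pow hj]; omega
  induction n using Nat.strong_induction_on with
  | _ n ih =>
  intro hn hd
  rcases Nat.lt_or_ge 1 n with h1 | h1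
  swap
  · exact ⟨0, n, hn, by simp, by simp, Or.inl (by omega)⟩
  rcases exists_optimal_split h1 with ⟨a, c, hc, hca, rfl, h2⟩ | ⟨a, b, ha, hb, rfl, h2⟩
  · refine ⟨0, a + c, hn, by simp, by simp, ?_⟩
    rcases Nat.lt_or_ge a 3 with h3 | h3
    · exact Or.inl (by omega)
    · have := defect_add_gap_le h3 hc hca h2
      exact Or.inr (Or.inr ⟨a, c, by omega, hc, hB a c hc hca h2 hd, rfl, h2, by linarith⟩)
  · have h3 := defect_mul (by omega) (by omega) h2
    have h4 := defect_nonneg (n := a) (by omega)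
    have h5 := defect_nonneg (n := b) (by omega)
    by_cases hb' : defect b < defectGap
    · exact key a b (by omega) hb (exists_eq_three_pow_of_defect_lt (by omega) hb') h2
        (ih a (by nlinarith) (by omega) (by linarith))
    by_cases ha' : defect a < defectGap
    · rw [mul_comm a b] at h2 ⊢
      exact key b a (by omega) ha (exists_eq_three_pow_of_defect_lt (by omega) ha')
        (by omega) (ih b (by nlinarith) (by omega) (by linarith))
    · exact ⟨0, a * b, hn, by simp, by simp, Or.inr (Or.inl ⟨a, b, by omega, by omega, rfl, h2,
        by linarith, by linarith⟩)⟩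

/-! ### Stable complexity, stable defects and residue classes -/

theorem IsStable.three_pow_mul {n : ℕ} (h : IsStable n) (k : ℕ) : IsStable (3 ^ k * n) := by
  intro j
  rw [← mul_assoc, ← pow_add, h, h]
  ring

theorem cpx_eq_stCpx_add {n k : ℕ} (hn : 0 < n) (hk : stabIndex n ≤ k) :
    (cpx (3 ^ k * n) : ℤ) = stCpx n + 3 * k := by
  obtain ⟨j, rfl⟩ := Nat.exists_eq_add_of_le' hk
  rw [pow_add, mul_assoc, isStable_stabIndex hn j, stCpx]
  push_cast
  ring

theorem stCpx_add_le_cpx {n : ℕ} (hn : 0 < n) (k : ℕ) :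
    stCpx n + 3 * k ≤ cpx (3 ^ k * n) := by
  have h1 := cpx_eq_stCpx_add (k := stabIndex n + k) hn (by omega)
  have h2 := cpx_three_pow_mul_le (n := 3 ^ k * n) (by positivity) (stabIndex n)
  rw [← mul_assoc, ← pow_add] at h2
  push_cast at h1
  omega

theorem stCpx_le_cpx {n : ℕ} (hn : 0 < n) : stCpx n ≤ cpx n := by
  simpa using stCpx_add_le_cpx hn 0

theorem stCpx_three_pow_mul {n : ℕ} (hn : 0 < n) (k : ℕ) :
    stCpx (3 ^ k * n) = stCpx n + 3 * k := by
  have h1 := cpx_eq_stCpx_add (n := 3 ^ k * n) (k := stabIndex (3 ^ k * n) + stabIndex n)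
    (by positivity) (by omega)
  have h2 := cpx_eq_stCpx_add (n := n) (k := stabIndex (3 ^ k * n) + stabIndex n + k) hn
    (by omega)
  rw [← mul_assoc, ← pow_add] at h1
  push_cast at *
  omega

theorem IsStable.stCpx_eq {n : ℕ} (hn : 0 < n) (h : IsStable n) : stCpx n = cpx n := by
  have h1 := cpx_eq_stCpx_add hn le_rfl
  rw [h] at h1
  push_cast at h1
  omega

theorem stCpx_mul_le {a b : ℕ} (ha : 0 < a) (hb : 0 < b) :
    stCpx (a * b) ≤ stCpx a + stCpx b := by
  have h1 := cpx_eq_stCpx_add ha le_rfl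
  have h2 := cpx_eq_stCpx_add hb le_rfl
  have h3 := stCpx_add_le_cpx (n := a * b) (by positivity) (stabIndex a + stabIndex b)
  have h4 := cpx_mul_le (a := 3 ^ stabIndex a * a) (b := 3 ^ stabIndex b * b)
    (by positivity) (by positivity)
  have h5 : 3 ^ stabIndex a * a * (3 ^ stabIndex b * b) =
    3 ^ (stabIndex a + stabIndex b) * (a * b) := by ring
  rw [h5] at h4
  push_cast at *
  omega

/-- Although ‖1‖ = 1, the stable value is 0, so n = n·1 is always an optimal factorization. This is
the source of the numbers n3^k+1. -/
theorem stCpx_one : stCpx 1 = 0 := by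
  have h := cpx_eq_stCpx_add (n := 1) (k := stabIndex 1 + 1) one_pos (by omega)
  rw [mul_one, cpx_three_pow (by omega)] at h
  push_cast at h
  omega

theorem stCpx_mul_add_one_le {a b k : ℕ} (ha : 0 < a) (hb : 0 < b) (hk : stabIndex a ≤ k) :
    stCpx (b * (a * 3 ^ k + 1)) ≤ stCpx a + stCpx b + 3 * k + 1 := by
  have h1 := stCpx_mul_le (a := b) (b := a * 3 ^ k + 1) hb (by positivity)
  have h2 := stCpx_le_cpx (n := a * 3 ^ k + 1) (by positivity)
  have h3 := cpx_add_le (a := a * 3 ^ k) (b := 1) (by positivity) one_pos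
  rw [cpx_one, mul_comm a] at h3
  rw [mul_comm a] at h1 h2 ⊢
  have h4 := cpx_eq_stCpx_add ha hk
  omega

theorem stDefect_eq {n : ℕ} (hn : 0 < n) : stDefect n = stCpx n - 3 * Real.logb 3 n := by
  rw [stDefect, defect, logb_three_natCast_mul (by positivity) hn, logb_three_pow, stCpx]
  push_cast
  ring

theorem stDefect_nonneg {n : ℕ} (hn : 0 < n) : 0 ≤ stDefect n :=
  defect_nonneg (by positivity)

theorem stDefect_three_pow_mul {n : ℕ} (hn : 0 < n) (k : ℕ) :
    stDefect (3 ^ k * n) = stDefect n := by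
  rw [stDefect_eq (by positivity), stDefect_eq hn, logb_three_natCast_mul (by positivity) hn,
    logb_three_pow, stCpx_three_pow_mul hn]
  push_cast
  ring

theorem IsStable.stDefect_eq {n : ℕ} (hn : 0 < n) (h : IsStable n) : stDefect n = defect n := by
  rw [IntegerComplexity.stDefect_eq hn, h.stCpx_eq hn, defect]
  simp

/-- If `A - 3 log₃ n = B - 3 log₃ m` for integers `A` and `B`, then `n` and `m` agree up to
powers of `3`. -/
theorem exists_three_pow_mul_eq {n m : ℕ} (hn : 0 < n) (hm : 0 < m) {A B : ℤ}
    (h : (A : ℝ) - 3 * Real.logb 3 n = B - 3 * Real.logb 3 m) :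
    ∃ p q : ℕ, 3 ^ p * n = 3 ^ q * m ∧ A + 3 * p = B + 3 * q := by
  have hn' : (0 : ℝ) < n := by exact_mod_cast hn
  have hm' : (0 : ℝ) < m := by exact_mod_cast hm
  -- The positive parts of B-A and A-B as exponents keep the cubed identity within the natural
  -- numbers.
  obtain ⟨i, j, hij⟩ : ∃ i j : ℕ, A + i = B + j :=
    ⟨(B - A).toNat, (A - B).toNat, by omega⟩
  have hijR : (A : ℝ) + i = B + j := by exact_mod_cast hij
  have h2 : 3 ^ i * n ^ 3 = 3 ^ j * m ^ 3 := by
    have h3 : Real.logb 3 ((3 : ℝ) ^ i * n ^ 3) = Real.logb 3 ((3 : ℝ) ^ j * m ^ 3) := by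
      rw [Real.logb_mul (by positivity) (by positivity),
        Real.logb_mul (by positivity) (by positivity), Real.logb_pow, Real.logb_pow,
        Real.logb_pow, Real.logb_pow, Real.logb_self_eq_one (by norm_num)]
      push_cast
      linarith
    have h4 := Real.logb_injOn_pos (b := 3) (by norm_num)
      (show (3 : ℝ) ^ i * n ^ 3 ∈ Set.Ioi 0 from by simp only [Set.mem_Ioi]; positivity)
      (show (3 : ℝ) ^ j * m ^ 3 ∈ Set.Ioi 0 from by simp only [Set.mem_Ioi]; positivity) h3
    exact_mod_cast h4
  obtain ⟨v, n', hn3, rfl⟩ := Nat.exists_eq_pow_mul_and_not_dvd hn.ne' 3 (by norm_num)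
  obtain ⟨w, m', hm3, rfl⟩ := Nat.exists_eq_pow_mul_and_not_dvd hm.ne' 3 (by norm_num)
  have h5 : 3 ^ (i + 3 * v) * n' ^ 3 = 3 ^ (j + 3 * w) * m' ^ 3 := by
    rw [pow_add, pow_add, pow_mul', pow_mul']
    linarith
  have hp : Nat.Prime 3 := Nat.prime_three
  -- Compare the exponents of 3 on both sides.
  have h6 : i + 3 * v = j + 3 * w := by
    have hv := congrArg (fun x => x.factorization 3) h5
    have hz : ∀ x : ℕ, ¬ 3 ∣ x → ∀ e, (3 ^ e * x ^ 3).factorization 3 = e := by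
      intro x hx e
      have hx0 : x ≠ 0 := by rintro rfl; simp at hx
      rw [Nat.factorization_mul (by positivity) (by positivity)]
      simp [Nat.factorization_eq_zero_of_not_dvd hx, hp.factorization_self]
    simpa only [hz _ hn3, hz _ hm3] using hv
  have h7 : n' = m' := by
    rw [h6] at h5
    exact Nat.pow_left_injective (n := 3) (by norm_num) (Nat.eq_of_mul_eq_mul_left (by positivity) h5)
  subst h7
  refine ⟨w, v, by ring, ?_⟩
  omega

/-- Stable defects determine the number up to powers of `3`, even modulo `1`. -/
theorem exists_three_pow_mul_eq_of_stDefect {n m : ℕ} (hn : 0 < n) (hm : 0 < m) {j : ℤ}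
    (h : stDefect n = stDefect m + j) :
    j = 0 ∧ ∃ p q : ℕ, 3 ^ p * n = 3 ^ q * m ∧ stCpx n + 3 * p = stCpx m + 3 * q := by
  rw [stDefect_eq hn, stDefect_eq hm] at h
  obtain ⟨p, q, h1, h2⟩ := exists_three_pow_mul_eq (A := stCpx n) (B := stCpx m + j) hn hm
    (by push_cast; linarith)
  have h3 := stCpx_three_pow_mul hn p
  have h4 := stCpx_three_pow_mul hm q
  rw [h1] at h3
  exact ⟨by omega, p, q, h1, by omega⟩

theorem stCpx_cast_eq_of_stDefect_eq {n m : ℕ} (hn : 0 < n) (hm : 0 < m)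
    (h : stDefect n = stDefect m) : (stCpx n : ZMod 3) = stCpx m := by
  obtain ⟨-, p, q, -, h2⟩ := exists_three_pow_mul_eq_of_stDefect (j := 0) hn hm (by simpa using h)
  have h3 := congrArg (fun z : ℤ => (z : ZMod 3)) h2
  push_cast at h3
  have h4 : (3 : ZMod 3) = 0 := rfl
  simpa [h4] using h3

/-- The stable defects of the numbers whose stable complexity modulo `3` lies in `U`. -/
def stDefectsIn (U : Set (ZMod 3)) : Set ℝ :=
  {x : ℝ | ∃ n : ℕ, 0 < n ∧ (stCpx n : ZMod 3) ∈ U ∧ x = stDefect n}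

theorem stDefect_mem_stDefectsIn {U : Set (ZMod 3)} {n : ℕ} (hn : 0 < n) :
    stDefect n ∈ stDefectsIn U ↔ (stCpx n : ZMod 3) ∈ U := by
  refine ⟨?_, fun h => ⟨n, hn, h, rfl⟩⟩
  rintro ⟨m, hm, hu, h⟩
  rwa [stCpx_cast_eq_of_stDefect_eq hn hm h]

theorem exists_isStable_of_mem_stDefectsIn {U : Set (ZMod 3)} {x : ℝ} (hx : x ∈ stDefectsIn U) :
    ∃ n, 1 < n ∧ IsStable n ∧ (cpx n : ZMod 3) ∈ U ∧ x = defect n ∧ x = stDefect n := by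
  -- One extra factor 3 ensures that the representative exceeds 1, also for n = 1.
  obtain ⟨n, hn, hu, rfl⟩ := hx
  have hs := (isStable_stabIndex hn).three_pow_mul 1
  rw [← mul_assoc, ← pow_add] at hs
  have h1 := cpx_eq_stCpx_add (k := 1 + stabIndex n) hn (by omega)
  have h2 : (3 : ZMod 3) = 0 := rfl
  have h3 := congrArg (fun z : ℤ => (z : ZMod 3)) h1
  push_cast [h2] at h3
  refine ⟨3 ^ (1 + stabIndex n) * n, ?_, hs, ?_, ?_, ?_⟩
  · rw [pow_add]
    have : 0 < 3 ^ stabIndex n * n := by positivity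
    nlinarith
  · rw [h3]; simpa using hu
  · rw [← hs.stDefect_eq (by positivity), stDefect_three_pow_mul hn]
  · rw [stDefect_three_pow_mul hn]

theorem stDefects_eq : stDefects = stDefectsIn Set.univ := by
  ext x
  constructor
  · rintro ⟨n, hn, hs, rfl⟩
    exact ⟨n, hn, trivial, (hs.stDefect_eq hn).symm⟩
  · intro hx
    obtain ⟨n, hn, hs, -, h, -⟩ := exists_isStable_of_mem_stDefectsIn hx
    exact ⟨n, by omega, hs, h⟩

/-- In the intersection, the number giving the class and the stable number may differ; having equal
defects, they agree up to powers of 3 with matching complexities, so the classes agree. -/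
theorem stDefectsMod_eq (u : ZMod 3) : stDefectsMod u = stDefectsIn {u} := by
  ext x
  constructor
  · rintro ⟨⟨n, hn, rfl, hx⟩, m, hm, hs, rfl⟩
    refine ⟨m, hm, ?_, (hs.stDefect_eq hm).symm⟩
    obtain ⟨p, q, -, h⟩ := exists_three_pow_mul_eq (A := cpx m) (B := cpx n) (n := m) (m := n)
      hm (by omega) (by simpa [defect] using hx)
    have h2 : (3 : ZMod 3) = 0 := rfl
    have h3 := congrArg (fun z : ℤ => (z : ZMod 3)) h
    push_cast [h2] at h3
    rw [hs.stCpx_eq hm]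
    simpa using h3
  · intro hx
    obtain ⟨n, hn, hs, hu, h, -⟩ := exists_isStable_of_mem_stDefectsIn hx
    exact ⟨⟨n, hn, hu, h⟩, n, by omega, hs, h⟩

/-! ### Subsequences of bounded defect -/

open Filter Topology

theorem exists_strictMono_eq_const_or_tendsto (K : ℕ → ℕ) :
    ∃ φ : ℕ → ℕ, StrictMono φ ∧ ((∃ v, ∀ i, K (φ i) = v) ∨ Tendsto (K ∘ φ) atTop atTop) := by
  by_cases h : Tendsto K atTop atTop
  · exact ⟨id, strictMono_id, Or.inr h⟩
  · rw [tendsto_atTop] at h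
    push Not at h
    obtain ⟨B, hB⟩ := h
    have h2 : ∃ᶠ i in atTop, ∃ v ∈ Set.Iio B, K i = v := by
      refine Frequently.mono hB fun i hi => ⟨K i, by simpa using hi, rfl⟩
    rw [frequently_exists_finite (Set.finite_Iio B)] at h2
    obtain ⟨v, -, hv⟩ := h2
    obtain ⟨φ, hφ, hv⟩ := extraction_of_frequently_atTop hv
    exact ⟨φ, hφ, Or.inl ⟨v, hv⟩⟩

/-- Values `m * 3 ^ K` at costs `s + 3 * K`. -/
def ConstForm (f c : ℕ → ℕ) : Prop :=
  ∃ (m : ℕ) (s : ℤ) (K : ℕ → ℕ), 0 < m ∧ stCpx m ≤ s ∧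
    ∀ i, f i = 3 ^ K i * m ∧ (c i : ℤ) = s + 3 * K i

/-- Values `3 ^ l * (b * (a * 3 ^ k + 1))`, where `k` tends to infinity. -/
def LinearForm (f c : ℕ → ℕ) : Prop :=
  ∃ (a b : ℕ) (s t : ℤ) (k l : ℕ → ℕ), 0 < a ∧ 0 < b ∧ stCpx a ≤ s ∧ stCpx b ≤ t ∧
    Tendsto k atTop atTop ∧
    ∀ i, f i = 3 ^ l i * (b * (a * 3 ^ k i + 1)) ∧ (c i : ℤ) = s + t + 3 * k i + 3 * l i + 1

/-- Values asymptotic from above to `m * 3 ^ K` at costs `s + 3 * K + j`; if `j ≠ 0` then `K`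
tends to infinity. -/
def AsympForm (j : ℕ) (f c : ℕ → ℕ) : Prop :=
  ∃ (m : ℕ) (s : ℤ) (K : ℕ → ℕ), 0 < m ∧ stCpx m ≤ s ∧ (1 ≤ j → Tendsto K atTop atTop) ∧
    (∀ i, 3 ^ K i * m ≤ f i) ∧ Tendsto (fun i => (f i : ℝ) / 3 ^ K i) atTop (𝓝 m) ∧
    ∀ i, (c i : ℤ) = s + 3 * K i + j

/-- The sequences of values and costs to which sequences of bounded defect are reduced. -/
def SeqForm (f c : ℕ → ℕ) : Prop :=
  ConstForm f c ∨ LinearForm f c ∨ ∃ j, 2 ≤ j ∧ AsympForm j f c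

theorem ConstForm.asympForm {f c : ℕ → ℕ} (h : ConstForm f c) : AsympForm 0 f c := by
  obtain ⟨m, s, K, hm, hs, h⟩ := h
  refine ⟨m, s, K, hm, hs, by simp, fun i => (h i).1.ge, ?_, fun i => by simpa using (h i).2⟩
  have : (fun i => (f i : ℝ) / 3 ^ K i) = fun _ => (m : ℝ) := by
    funext i
    rw [(h i).1]
    push_cast
    field_simp
  rw [this]
  exact tendsto_const_nhds

theorem tendsto_inv_three_pow {k : ℕ → ℕ} (hk : Tendsto k atTop atTop) :
    Tendsto (fun i => ((3 : ℝ) ^ k i)⁻¹) atTop (𝓝 0) :=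
  tendsto_inv_atTop_zero.comp ((tendsto_pow_atTop_atTop_of_one_lt (by norm_num)).comp hk)

theorem LinearForm.asympForm {f c : ℕ → ℕ} (h : LinearForm f c) : AsympForm 1 f c := by
  obtain ⟨a, b, s, t, k, l, ha, hb, hs, ht, hk, h⟩ := h
  refine ⟨a * b, s + t, fun i => k i + l i, by positivity,
    (stCpx_mul_le ha hb).trans (add_le_add hs ht),
    fun _ => tendsto_atTop_mono (fun i => Nat.le_add_right _ _) hk, fun i => ?_, ?_, fun i => ?_⟩
  · rw [(h i).1]
    calc 3 ^ (k i + l i) * (a * b) = 3 ^ l i * (b * (a * 3 ^ k i)) := by ring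
      _ ≤ _ := by gcongr; omega
  · have : (fun i => (f i : ℝ) / 3 ^ (k i + l i)) = fun i => b * (a + ((3 : ℝ) ^ k i)⁻¹) := by
      funext i
      rw [(h i).1, pow_add]
      push_cast
      field_simp
    rw [this]
    have h2 := ((tendsto_inv_three_pow hk).const_add (a : ℝ)).const_mul (b : ℝ)
    convert h2 using 2
    push_cast
    ring
  · rw [(h i).2]
    push_cast
    ring

theorem AsympForm.mul {j j' : ℕ} {f c f' c' : ℕ → ℕ} (h : AsympForm j f c)
    (h' : AsympForm j' f' c') : AsympForm (j + j') (f * f') (c + c') := by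
  obtain ⟨m, s, K, hm, hs, hK, h1, h2, h3⟩ := h
  obtain ⟨m', s', K', hm', hs', hK', h1', h2', h3'⟩ := h'
  refine ⟨m * m', s + s', fun i => K i + K' i, by positivity,
    (stCpx_mul_le hm hm').trans (add_le_add hs hs'), fun hj => ?_, fun i => ?_, ?_, fun i => ?_⟩
  · rcases Nat.lt_or_ge 0 j with hj0 | hj0
    · exact tendsto_atTop_mono (fun i => Nat.le_add_right _ _) (hK hj0)
    · exact tendsto_atTop_mono (fun i => Nat.le_add_left _ _) (hK' (by omega))
  · calc 3 ^ (K i + K' i) * (m * m') = (3 ^ K i * m) * (3 ^ K' i * m') := by ring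
      _ ≤ _ := Nat.mul_le_mul (h1 i) (h1' i)
  · have := h2.mul h2'
    simp only [Pi.mul_apply]
    push_cast
    refine this.congr fun i => ?_
    rw [pow_add]
    field_simp
  · simp only [Pi.add_apply]
    push_cast
    rw [h3, h3']
    ring

theorem AsympForm.add_const {j : ℕ} {f c : ℕ → ℕ} (h : AsympForm j f c)
    (hj : 1 ≤ j) (x y : ℕ) : AsympForm (j + y) (fun i => f i + x) (fun i => c i + y) := by
  obtain ⟨m, s, K, hm, hs, hK, h1, h2, h3⟩ := h
  refine ⟨m, s, K, hm, hs, fun _ => hK hj, fun i => (h1 i).trans (Nat.le_add_right _ _), ?_,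
    fun i => ?_⟩
  · have := h2.add ((tendsto_inv_three_pow (hK hj)).const_mul (x : ℝ))
    rw [mul_zero, add_zero] at this
    refine this.congr fun i => ?_
    push_cast
    field_simp
  · push_cast
    rw [h3]
    ring

theorem ConstForm.mul {f c f' c' : ℕ → ℕ} (h : ConstForm f c) (h' : ConstForm f' c') :
    ConstForm (f * f') (c + c') := by
  obtain ⟨m, s, K, hm, hs, h⟩ := h
  obtain ⟨m', s', K', hm', hs', h'⟩ := h'
  refine ⟨m * m', s + s', fun i => K i + K' i, by positivity,
    (stCpx_mul_le hm hm').trans (add_le_add hs hs'), fun i => ⟨?_, ?_⟩⟩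
  · rw [Pi.mul_apply, (h i).1, (h' i).1]
    ring
  · rw [Pi.add_apply]
    push_cast
    rw [(h i).2, (h' i).2]
    ring

theorem ConstForm.mul_linearForm {f c f' c' : ℕ → ℕ} (h : ConstForm f c)
    (h' : LinearForm f' c') : LinearForm (f * f') (c + c') := by
  obtain ⟨m, s, K, hm, hs, h⟩ := h
  obtain ⟨a, b, s', t', k, l, ha, hb, hs', ht', hk, h'⟩ := h'
  refine ⟨a, m * b, s', s + t', k, fun i => K i + l i, ha, by positivity, hs',
    (stCpx_mul_le hm hb).trans (add_le_add hs ht'), hk, fun i => ⟨?_, ?_⟩⟩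
  · rw [Pi.mul_apply, (h i).1, (h' i).1]
    ring
  · rw [Pi.add_apply]
    push_cast
    rw [(h i).2, (h' i).2]
    ring

/-- The excess j is 0, 1 or at least 2 for the three forms, and it adds under multiplication. Only
the products with total excess below 2 need an exact shape, and these have at least one constant
factor. -/
theorem SeqForm.mul {f c f' c' : ℕ → ℕ} (h : SeqForm f c) (h' : SeqForm f' c') :
    SeqForm (f * f') (c + c') := by
  have key : ∀ j j', 2 ≤ j + j' → AsympForm j f c → AsympForm j' f' c' →
      SeqForm (f * f') (c + c') := fun j j' hj h1 h2 => Or.inr (Or.inr ⟨_, hj, h1.mul h2⟩)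
  rcases h with h | h | ⟨j, hj, h⟩ <;> rcases h' with h' | h' | ⟨j', hj', h'⟩
  · exact Or.inl (h.mul h')
  · exact Or.inr (Or.inl (h.mul_linearForm h'))
  · exact key _ _ (by omega) h.asympForm h'
  · rw [mul_comm, add_comm]
    exact Or.inr (Or.inl (h'.mul_linearForm h))
  · exact key _ _ (by omega) h.asympForm h'.asympForm
  · exact key _ _ (by omega) h.asympForm h'
  · exact key _ _ (by omega) h h'.asympForm
  · exact key _ _ (by omega) h h'.asympForm
  · exact key _ _ (by omega) h h'

theorem SeqForm.comp {f c : ℕ → ℕ} (h : SeqForm f c) {φ : ℕ → ℕ} (hφ : StrictMono φ) :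
    SeqForm (f ∘ φ) (c ∘ φ) := by
  rcases h with ⟨m, s, K, hm, hs, h⟩ | ⟨a, b, s, t, k, l, ha, hb, hs, ht, hk, h⟩ |
    ⟨j, hj, m, s, K, hm, hs, hK, h1, h2, h3⟩
  · exact Or.inl ⟨m, s, K ∘ φ, hm, hs, fun i => h (φ i)⟩
  · exact Or.inr (Or.inl ⟨a, b, s, t, k ∘ φ, l ∘ φ, ha, hb, hs, ht,
      hk.comp hφ.tendsto_atTop, fun i => h (φ i)⟩)
  · exact Or.inr (Or.inr ⟨j, hj, m, s, K ∘ φ, hm, hs, fun h => (hK h).comp hφ.tendsto_atTop,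
      fun i => h1 (φ i), h2.comp hφ.tendsto_atTop, fun i => h3 (φ i)⟩)

theorem constForm_const {m c : ℕ} (hm : 0 < m) (hc : cpx m ≤ c) :
    ConstForm (fun _ => m) (fun _ => c) :=
  ⟨m, c, fun _ => 0, hm, (stCpx_le_cpx hm).trans (by exact_mod_cast hc), fun i => by simp⟩

theorem constForm_three_pow (k : ℕ → ℕ) :
    ConstForm (fun i => 3 ^ k i) (fun i => 3 * k i) :=
  ⟨1, 0, k, one_pos, stCpx_one.le, fun i => by simp⟩

/-- For the constant form, make K constant or divergent. In the divergent case adding 1 creates the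
linear form, and adding more costs at least two 1's. The other forms already have excess at least 1,
so the sum has excess at least 2. -/
theorem SeqForm.exists_add_const {f c : ℕ → ℕ} (h : SeqForm f c) (hc : ∀ i, cpx (f i) ≤ c i)
    {x : ℕ} (hx : 0 < x) : ∃ φ : ℕ → ℕ, StrictMono φ ∧
      SeqForm (fun i => f (φ i) + x) (fun i => c (φ i) + cpx x) := by
  have hx' := cpx_pos hx
  rcases h with ⟨m, s, K, hm, hs, h⟩ | h | ⟨j, hj, h⟩
  · obtain ⟨φ, hφ, ⟨v, hv⟩ | hK⟩ := exists_strictMono_eq_const_or_tendsto K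
    · refine ⟨φ, hφ, Or.inl ?_⟩
      have h1 : ∀ i, f (φ i) = f (φ 0) := fun i => by rw [(h _).1, (h _).1, hv, hv]
      have h2 : ∀ i, c (φ i) = c (φ 0) := fun i => by
        have := (h (φ i)).2
        have := (h (φ 0)).2
        have := hv i
        have := hv 0
        omega
      have h3 : 0 < f (φ 0) := by rw [(h _).1]; positivity
      simp only [h1, h2]
      exact constForm_const (by positivity)
        ((cpx_add_le h3 hx).trans (Nat.add_le_add_right (hc _) _))
    · refine ⟨φ, hφ, ?_⟩
      rcases Nat.lt_or_ge 1 x with h1 | h1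
      · refine Or.inr (Or.inr ⟨cpx x, two_le_cpx h1, m, s, K ∘ φ, hm, hs, fun _ => hK,
          fun i => ?_, ?_, fun i => ?_⟩)
        · beta_reduce
          rw [(h _).1]
          exact Nat.le_add_right _ _
        · have := ((tendsto_inv_three_pow hK).const_mul (x : ℝ)).const_add (m : ℝ)
          rw [mul_zero, add_zero] at this
          refine this.congr fun i => ?_
          beta_reduce
          rw [(h _).1]
          push_cast
          simp only [Function.comp]
          field_simp
        · push_cast
          rw [(h _).2]
          rfl
      · obtain rfl : x = 1 := by omega
        refine Or.inr (Or.inl ⟨m, 1, s, 0, K ∘ φ, fun _ => 0, hm, one_pos, hs, stCpx_one.le,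
          hK, fun i => ⟨?_, ?_⟩⟩)
        · beta_reduce
          rw [(h _).1]
          simp [mul_comm]
        · rw [cpx_one]
          push_cast
          rw [(h _).2]
          simp
  · exact ⟨id, strictMono_id, Or.inr (Or.inr ⟨_, by omega, h.asympForm.add_const le_rfl _ _⟩)⟩
  · exact ⟨id, strictMono_id, Or.inr (Or.inr ⟨_, by omega, h.add_const (by omega) _ _⟩)⟩

/-- Every sequence of numbers of bounded defect has a subsequence of one of the three forms. -/
theorem exists_seqForm_of_defect_lt (N : ℕ) (n : ℕ → ℕ) (hn : ∀ i, 0 < n i)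
    (hd : ∀ i, defect (n i) < N * defectGap) :
    ∃ φ : ℕ → ℕ, StrictMono φ ∧ SeqForm (n ∘ φ) (cpx ∘ n ∘ φ) := by
  induction N generalizing n with
  | zero =>
    have h1 := hd 0
    have h2 := defect_nonneg (hn 0)
    simp at h1
    linarith
  | succ N ih =>
    obtain ⟨B, hB⟩ := exists_bounded_split N
    choose k m hm hnm hc h using fun i => hB (n i) (hn i) (by exact_mod_cast hd i)
    suffices ∃ φ : ℕ → ℕ, StrictMono φ ∧ SeqForm (m ∘ φ) (cpx ∘ m ∘ φ) by
      obtain ⟨φ, hφ, h⟩ := this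
      refine ⟨φ, hφ, ?_⟩
      have h1 := SeqForm.mul (Or.inl (constForm_three_pow (k ∘ φ))) h
      convert h1 using 1
      · funext i; exact hnm (φ i)
      · funext i; exact hc (φ i)
    clear hB hnm hc hn hd n k
    -- One of the three alternatives occurs for infinitely many indices.
    have h' : ∃ᶠ i in atTop, _ := (Eventually.of_forall h).frequently
    rw [frequently_or_distrib, frequently_or_distrib] at h'
    rcases h' with h' | h' | h'
    · have h2 : ∃ᶠ i in atTop, ∃ v ∈ Set.Iic 4, m i = v :=
        h'.mono fun i hi => ⟨m i, hi, rfl⟩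
      rw [frequently_exists_finite (Set.finite_Iic 4)] at h2
      obtain ⟨v, -, hv⟩ := h2
      obtain ⟨φ, hφ, hv⟩ := extraction_of_frequently_atTop hv
      refine ⟨φ, hφ, Or.inl ?_⟩
      have h3 := constForm_const (m := v) (hv 0 ▸ hm _) le_rfl
      convert h3 using 1
      · funext i; exact hv i
      · funext i; exact congrArg cpx (hv i)
    · obtain ⟨φ, hφ, hv⟩ := extraction_of_frequently_atTop h'
      choose u v hu hv huv hc hdu hdv using hv
      -- Extract twice, so that both factors have a good form along the same indices.
      obtain ⟨ψ, hψ, h1⟩ := ih u hu hdu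
      obtain ⟨χ, hχ, h2⟩ := ih (v ∘ ψ) (fun i => hv _) (fun i => hdv _)
      refine ⟨φ ∘ ψ ∘ χ, hφ.comp (hψ.comp hχ), ?_⟩
      convert (h1.comp hχ).mul h2 using 1
      · funext i; exact huv _
      · funext i; exact hc _
    · have h2 : ∃ᶠ i in atTop, ∃ x ∈ Set.Iic B, ∃ a, 0 < a ∧ 0 < x ∧ m i = a + x ∧
          cpx (m i) = cpx a + cpx x ∧ defect a < N * defectGap :=
        h'.mono fun i ⟨a, c, h1, h2, h3, h4⟩ => ⟨c, h3, a, h1, h2, h4⟩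
      rw [frequently_exists_finite (Set.finite_Iic B)] at h2
      obtain ⟨x, -, hx⟩ := h2
      obtain ⟨φ, hφ, hx⟩ := extraction_of_frequently_atTop hx
      choose a ha hx hax hc hda using hx
      obtain ⟨ψ, hψ, h1⟩ := ih a ha hda
      obtain ⟨χ, hχ, h2⟩ := h1.exists_add_const (fun i => le_rfl) (hx 0)
      refine ⟨φ ∘ ψ ∘ χ, hφ.comp (hψ.comp hχ), ?_⟩
      convert h2 using 1
      · funext i; exact hax _
      · funext i; exact hc _

/-! ### Limits of stable defects -/

theorem logb_linear {a b : ℕ} (ha : 0 < a) (hb : 0 < b) (k : ℕ) :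
    Real.logb 3 ((b * (a * 3 ^ k + 1) : ℕ) : ℝ) =
      Real.logb 3 ((a * b : ℕ) : ℝ) + k + Real.logb 3 (1 + ((a : ℝ) * 3 ^ k)⁻¹) := by
  have ha' : (0 : ℝ) < a := by exact_mod_cast ha
  have hb' : (0 : ℝ) < b := by exact_mod_cast hb
  have h : ((b * (a * 3 ^ k + 1) : ℕ) : ℝ) =
      ((a * b : ℕ) : ℝ) * ((3 ^ k : ℕ) : ℝ) * (1 + ((a : ℝ) * 3 ^ k)⁻¹) := by
    push_cast
    field_simp
  rw [h, Real.logb_mul (by positivity) (by positivity),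
    Real.logb_mul (by positivity) (by positivity), logb_three_pow]

theorem logb_one_add_inv_pos {a : ℕ} (ha : 0 < a) (k : ℕ) :
    0 < Real.logb 3 (1 + ((a : ℝ) * 3 ^ k)⁻¹) := by
  have ha' : (0 : ℝ) < a := by exact_mod_cast ha
  refine Real.logb_pos (by norm_num) ?_
  have : 0 < ((a : ℝ) * 3 ^ k)⁻¹ := by positivity
  linarith

theorem logb_one_add_inv_strictAnti {a : ℕ} (ha : 0 < a) :
    StrictAnti fun k : ℕ => Real.logb 3 (1 + ((a : ℝ) * 3 ^ k)⁻¹) := by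
  have ha' : (0 : ℝ) < a := by exact_mod_cast ha
  intro k l hkl
  refine Real.logb_lt_logb (by norm_num) (by positivity) ?_
  have : (a : ℝ) * 3 ^ k < a * 3 ^ l := by gcongr; norm_num
  gcongr

theorem tendsto_logb_one_add_inv {a : ℕ} (ha : 0 < a) {k : ℕ → ℕ} (hk : Tendsto k atTop atTop) :
    Tendsto (fun i => Real.logb 3 (1 + ((a : ℝ) * 3 ^ k i)⁻¹)) atTop (𝓝 0) := by
  have ha' : (0 : ℝ) < a := by exact_mod_cast ha
  have h1 := ((tendsto_inv_three_pow hk).const_mul ((a : ℝ)⁻¹)).const_add 1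
  have h2 : Tendsto (Real.logb 3) (𝓝 (1 + (a : ℝ)⁻¹ * 0)) (𝓝 0) := by
    have := (Real.continuousAt_logb (b := 3) (x := 1) (by norm_num)).tendsto
    simpa using this
  refine (h2.comp h1).congr fun i => ?_
  simp [mul_comm]

theorem AsympForm.defect_tendsto {j : ℕ} {f c : ℕ → ℕ} (h : AsympForm j f c) :
    ∃ (m : ℕ) (s : ℤ), 0 < m ∧ stCpx m ≤ s ∧
      (∀ i, (c i : ℝ) - 3 * Real.logb 3 (f i) ≤ s + j - 3 * Real.logb 3 m) ∧
      Tendsto (fun i => (c i : ℝ) - 3 * Real.logb 3 (f i)) atTop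
        (𝓝 (s + j - 3 * Real.logb 3 m)) ∧
      ∀ i, ∃ K : ℕ, (c i : ℤ) = s + 3 * K + j := by
  obtain ⟨m, s, K, hm, hs, hK, h1, h2, h3⟩ := h
  have hm' : (0 : ℝ) < m := by exact_mod_cast hm
  have hf : ∀ i, (0 : ℝ) < f i := fun i => by
    have : 0 < 3 ^ K i * m := by positivity
    exact_mod_cast this.trans_le (h1 i)
  have h4 : ∀ i, (c i : ℝ) - 3 * Real.logb 3 (f i) =
      s + j - 3 * Real.logb 3 (f i / 3 ^ K i) := by
    intro i
    have h5 : (c i : ℝ) = s + 3 * K i + j := by exact_mod_cast h3 i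
    rw [h5, Real.logb_div (hf i).ne' (by positivity), Real.logb_pow,
      Real.logb_self_eq_one (by norm_num)]
    ring
  refine ⟨m, s, hm, hs, fun i => ?_, ?_, fun i => ⟨K i, h3 i⟩⟩
  · rw [h4]
    have : Real.logb 3 m ≤ Real.logb 3 (f i / 3 ^ K i) := by
      refine Real.logb_le_logb_of_le (by norm_num) hm' ?_
      rw [le_div_iff₀ (by positivity), mul_comm]
      exact_mod_cast h1 i
    linarith
  · simp only [h4]
    exact (((Real.continuousAt_logb hm'.ne').tendsto.comp h2).const_mul 3).const_sub _

/-- A sequence of bounded stable defects has a subsequence that is represented by stable numbers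
in one of the three forms. -/
theorem exists_seqForm_of_stDefect_le {n : ℕ → ℕ} (hn : ∀ i, 0 < n i) {R : ℝ}
    (hR : ∀ i, stDefect (n i) ≤ R) :
    ∃ φ f : ℕ → ℕ, StrictMono φ ∧ SeqForm f (cpx ∘ f) ∧
      ∀ i, 0 < f i ∧ stDefect (f i) = stDefect (n (φ i)) ∧ stCpx (f i) = cpx (f i) ∧
        stDefect (n (φ i)) = cpx (f i) - 3 * Real.logb 3 (f i) := by
  obtain ⟨N, hN⟩ := exists_nat_gt (R / defectGap)
  rw [div_lt_iff₀ defectGap_pos] at hN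
  have hs : ∀ i, IsStable (3 ^ stabIndex (n i) * n i) := fun i => isStable_stabIndex (hn i)
  have hp : ∀ i, 0 < 3 ^ stabIndex (n i) * n i := fun i => by have := hn i; positivity
  obtain ⟨φ, hφ, h⟩ := exists_seqForm_of_defect_lt N (fun i => 3 ^ stabIndex (n i) * n i) hp
    (fun i => (hR i).trans_lt hN)
  exact ⟨φ, _, hφ, h, fun i => ⟨hp _, stDefect_three_pow_mul (hn _) _, (hs _).stCpx_eq (hp _),
    rfl⟩⟩

/-- Along a subsequence the defects converge without exceeding their limit, which a strictly
decreasing sequence cannot do. -/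
theorem not_strictAnti_stDefect {n : ℕ → ℕ} (hn : ∀ i, 0 < n i) :
    ¬ StrictAnti (stDefect ∘ n) := by
  intro h
  obtain ⟨φ, f, hφ, hf, h1⟩ := exists_seqForm_of_stDefect_le hn (fun i => h.antitone (Nat.zero_le i))
  obtain ⟨j, hj⟩ : ∃ j, AsympForm j f (cpx ∘ f) := by
    rcases hf with hf | hf | ⟨j, -, hf⟩
    exacts [⟨0, hf.asympForm⟩, ⟨1, hf.asympForm⟩, ⟨j, hf⟩]
  obtain ⟨m, s, -, -, h2, h3, -⟩ := hj.defect_tendsto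
  have h4 : ∀ i, ((cpx ∘ f) i : ℝ) - 3 * Real.logb 3 (f i) = (stDefect ∘ n ∘ φ) i :=
    fun i => ((h1 i).2.2.2).symm
  simp only [h4] at h2 h3
  have h5 : StrictAnti (stDefect ∘ n ∘ φ) := fun i j hij => h (hφ hij)
  have h6 := h5.antitone.le_of_tendsto h3 1
  have h7 := h5 zero_lt_one
  have h8 := h2 0
  linarith

theorem stDefectsIn_isWF (U : Set (ZMod 3)) : (stDefectsIn U).IsWF := by
  rw [Set.isWF_iff_no_descending_seq]
  intro x hx hmem
  choose n hn hU hxn using hmem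
  refine not_strictAnti_stDefect hn ?_
  have : stDefect ∘ n = x := funext fun i => (hxn i).symm
  rwa [this]

/-- The limit of a strictly increasing sequence of stable defects is of the form `δ_st(m) + j`
with `j ≥ 1`; if `j = 1`, then some term is `δ_st(b(a3ᵏ + 1))` with an optimal factorization
`m = ab`. -/
theorem exists_of_strictMono_stDefect {n : ℕ → ℕ} (hn : ∀ i, 0 < n i)
    (hx : StrictMono (stDefect ∘ n)) {L : ℝ} (hL : Tendsto (stDefect ∘ n) atTop (𝓝 L)) :
    ∃ (m : ℕ) (j : ℤ), 0 < m ∧ 1 ≤ j ∧ L = stDefect m + j ∧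
      (∃ i, (stCpx (n i) : ZMod 3) = stCpx m + j) ∧
      (j = 1 → ∃ i a b k, 0 < a ∧ 0 < b ∧ a * b = m ∧ stCpx m = stCpx a + stCpx b ∧
        stDefect (n i) = stDefect (b * (a * 3 ^ k + 1))) := by
  obtain ⟨φ, f, hφ, hf, h1⟩ := exists_seqForm_of_stDefect_le hn
    (fun i => hx.monotone.ge_of_tendsto hL i)
  have hLφ := hL.comp hφ.tendsto_atTop
  have h30 : (3 : ZMod 3) = 0 := rfl
  have hcast : ∀ i, (stCpx (n (φ i)) : ZMod 3) = cpx (f i) := fun i => by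
    rw [← stCpx_cast_eq_of_stDefect_eq (h1 i).1 (hn _) (h1 i).2.1, (h1 i).2.2.1]
    simp
  rcases hf with ⟨m, s, K, hm, -, h⟩ | ⟨a, b, s, t, k, l, ha, hb, hs, ht, hk, h⟩ | ⟨j, hj, hf⟩
  · exfalso
    have h2 : ∀ i, stDefect (n (φ i)) = stDefect m := fun i => by
      rw [← (h1 i).2.1, (h i).1, stDefect_three_pow_mul hm]
    exact (hx (hφ zero_lt_one)).ne ((h2 0).trans (h2 1).symm)
  · have h2 : ∀ i, stDefect (n (φ i)) = s + t + 1 - 3 * Real.logb 3 ((a * b : ℕ) : ℝ) -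
        3 * Real.logb 3 (1 + ((a : ℝ) * 3 ^ k i)⁻¹) := by
      intro i
      have h3 := (h i).2
      simp only [Function.comp] at h3
      have h4 : (cpx (f i) : ℝ) = s + t + 3 * k i + 3 * l i + 1 := by exact_mod_cast h3
      rw [(h1 i).2.2.2, h4, (h i).1, logb_three_natCast_mul (by positivity) (by positivity),
        logb_three_pow, logb_linear ha hb]
      ring
    have h5 := ((tendsto_logb_one_add_inv ha hk).const_mul 3).const_sub
      ((s : ℝ) + t + 1 - 3 * Real.logb 3 ((a * b : ℕ) : ℝ))
    rw [mul_zero, sub_zero] at h5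
    have h6 := tendsto_nhds_unique hLφ (h5.congr fun i => (h2 i).symm)
    have hab := stCpx_mul_le ha hb
    -- Here s ≥ ‖a‖_st, t ≥ ‖b‖_st and ‖ab‖_st ≤ ‖a‖_st + ‖b‖_st, so j = 1 forces equality
    -- throughout.
    refine ⟨a * b, s + t + 1 - stCpx (a * b), by positivity, by omega, ?_, ⟨φ 0, ?_⟩,
      fun hj => ⟨φ 0, a, b, k 0, ha, hb, rfl, by omega, ?_⟩⟩
    · rw [h6, stDefect_eq (by positivity)]
      push_cast
      ring
    · have h3 := congrArg (fun z : ℤ => (z : ZMod 3)) (h 0).2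
      simp only [Function.comp] at h3
      push_cast [h30] at h3
      rw [hcast, h3]
      push_cast
      ring
    · rw [← (h1 0).2.1, (h 0).1, stDefect_three_pow_mul (by positivity)]
  · obtain ⟨m, s, hm, hs, -, h3, h4⟩ := hf.defect_tendsto
    have h6 := tendsto_nhds_unique hLφ (h3.congr fun i => (h1 i).2.2.2.symm)
    refine ⟨m, s + j - stCpx m, hm, by omega, ?_, ⟨φ 0, ?_⟩, by omega⟩
    · rw [h6, stDefect_eq hm]
      push_cast
      ring
    · obtain ⟨K, hK⟩ := h4 0
      have h3 := congrArg (fun z : ℤ => (z : ZMod 3)) hK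
      simp only [Function.comp] at h3
      push_cast [h30] at h3
      rw [hcast, h3]
      push_cast
      ring

/-- The limit would also be δ_st(m')+j with j ≥ 1, but stable defects that differ by an integer are
equal. -/
theorem not_tendsto_stDefect_of_strictMono {n : ℕ → ℕ} (hn : ∀ i, 0 < n i)
    (hx : StrictMono (stDefect ∘ n)) {m : ℕ} (hm : 0 < m) {d : ℕ} :
    ¬ Tendsto (stDefect ∘ n) atTop (𝓝 (stDefect m - d)) := by
  intro hL
  obtain ⟨m', j, hm', hj, h, -⟩ := exists_of_strictMono_stDefect hn hx hL
  have := (exists_three_pow_mul_eq_of_stDefect (j := j + d) hm hm'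
    (by push_cast; linarith)).1
  omega

/-- Optimal factorizations `n = ab` give `‖b(a3ᵏ + 1)‖_st = ‖n‖_st + 3k + 1` for large `k`. -/
theorem eventually_stCpx_linear {a b : ℕ} (ha : 0 < a) (hb : 0 < b)
    (hab : stCpx (a * b) = stCpx a + stCpx b) :
    ∀ᶠ k : ℕ in atTop, stCpx (b * (a * 3 ^ k + 1)) = stCpx (a * b) + 3 * k + 1 := by
  by_contra hcon
  have hpos : ∀ k, 0 < b * (a * 3 ^ k + 1) := fun k => by positivity
  obtain ⟨M, hM⟩ := exists_nat_gt (stDefect (a * b) + 1)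
  -- The shortfall d is bounded since stable defects are nonnegative, so one d ≥ 1 recurs infinitely
  -- often. Along those k the stable defects increase to δ_st(ab)-(d-1), which is not a possible
  -- limit.
  have h1 : ∃ᶠ k : ℕ in atTop, ∃ d ∈ Set.Iio M, 1 ≤ d ∧
      stCpx (b * (a * 3 ^ k + 1)) + d = stCpx (a * b) + 3 * k + 1 := by
    rw [Filter.not_eventually] at hcon
    refine (hcon.and_eventually (eventually_ge_atTop (stabIndex a))).mono fun k ⟨h2, h3⟩ => ?_
    have h4 := stCpx_mul_add_one_le ha hb h3
    obtain ⟨d, hd⟩ := Int.eq_ofNat_of_zero_le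
      (show 0 ≤ stCpx (a * b) + 3 * k + 1 - stCpx (b * (a * 3 ^ k + 1)) by omega)
    refine ⟨d, ?_, by omega, by omega⟩
    have h5 := stDefect_nonneg (hpos k)
    rw [stDefect_eq (hpos k), logb_linear ha hb] at h5
    rw [stDefect_eq (by positivity)] at hM
    have h6 : (stCpx (a * b) : ℝ) + 3 * k + 1 - stCpx (b * (a * 3 ^ k + 1)) = d := by
      exact_mod_cast hd
    have h7 := logb_one_add_inv_pos ha k
    have h8 : (d : ℝ) < M := by linarith
    exact_mod_cast h8
  rw [frequently_exists_finite (Set.finite_Iio M)] at h1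
  obtain ⟨d, -, h1⟩ := h1
  obtain ⟨φ, hφ, h1⟩ := extraction_of_frequently_atTop h1
  have h2 : ∀ i, stDefect (b * (a * 3 ^ φ i + 1)) =
      stDefect (a * b) + 1 - d - 3 * Real.logb 3 (1 + ((a : ℝ) * 3 ^ φ i)⁻¹) := by
    intro i
    have h3 : (stCpx (b * (a * 3 ^ φ i + 1)) : ℝ) + d = stCpx (a * b) + 3 * φ i + 1 := by
      exact_mod_cast (h1 i).2
    rw [stDefect_eq (hpos _), stDefect_eq (by positivity), logb_linear ha hb]
    linarith
  have hd : 1 ≤ d := (h1 0).1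
  refine not_tendsto_stDefect_of_strictMono (n := fun i => b * (a * 3 ^ φ i + 1))
    (fun i => hpos _) (m := a * b) ?_ (by positivity) (d := d - 1) ?_
  · intro i j hij
    simp only [Function.comp, h2]
    have := logb_one_add_inv_strictAnti ha (hφ hij)
    simp only at this
    linarith
  · have h5 := ((tendsto_logb_one_add_inv ha hφ.tendsto_atTop).const_mul 3).const_sub
      (stDefect (a * b) + 1 - d)
    rw [mul_zero, sub_zero] at h5
    have h6 : stDefect (a * b) - ((d - 1 : ℕ) : ℝ) = stDefect (a * b) + 1 - d := by
      push_cast [hd]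
      ring
    rw [h6]
    exact h5.congr fun i => (h2 i).symm

theorem eventually_stDefect_linear {a b : ℕ} (ha : 0 < a) (hb : 0 < b)
    (hab : stCpx (a * b) = stCpx a + stCpx b) :
    ∀ᶠ k : ℕ in atTop, (stCpx (b * (a * 3 ^ k + 1)) : ZMod 3) = stCpx (a * b) + 1 ∧
      stDefect (b * (a * 3 ^ k + 1)) =
        stDefect (a * b) + 1 - 3 * Real.logb 3 (1 + ((a : ℝ) * 3 ^ k)⁻¹) := by
  refine (eventually_stCpx_linear ha hb hab).mono fun k hk => ?_
  rw [hk, stDefect_eq (by positivity), stDefect_eq (by positivity), hk, logb_linear ha hb]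
  have h30 : (3 : ZMod 3) = 0 := rfl
  push_cast [h30]
  constructor <;> ring

theorem eventually_stDefect_linear_mem_Ioo {a b : ℕ} (ha : 0 < a) (hb : 0 < b)
    (hab : stCpx (a * b) = stCpx a + stCpx b) {t : ℝ} (ht : t < stDefect (a * b) + 1) :
    ∀ᶠ k : ℕ in atTop, stDefect (b * (a * 3 ^ k + 1)) ∈ Set.Ioo t (stDefect (a * b) + 1) := by
  have h5 := ((tendsto_logb_one_add_inv ha tendsto_id).const_mul 3).const_sub
      (stDefect (a * b) + 1)
  rw [mul_zero, sub_zero] at h5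
  filter_upwards [eventually_stDefect_linear ha hb hab, h5.eventually (lt_mem_nhds ht)]
    with k hk hk'
  rw [hk.2]
  have := logb_one_add_inv_pos ha k
  exact ⟨hk', by linarith⟩

/-- `δ_st(m) + i` is a limit from below or an element of the stable defects in the class of
`‖m‖_st + i`. -/
theorem stDefect_add_mem_closure (i : ℕ) {m : ℕ} (hm : 0 < m) {U : Set (ZMod 3)}
    (hU : (stCpx m : ZMod 3) + i ∈ U) : stDefect m + i ∈ closure (stDefectsIn U) := by
  induction i generalizing m with
  | zero => exact subset_closure (by simpa [stDefect_mem_stDefectsIn hm] using hU)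
  | succ i ih =>
    have h1 : stCpx (m * 1) = stCpx m + stCpx 1 := by simp [stCpx_one]
    have h2 := eventually_stDefect_linear hm one_pos h1
    have h5 := (((tendsto_logb_one_add_inv hm tendsto_id).const_mul 3).const_sub
      (stDefect (m * 1) + 1)).add_const (i : ℝ)
    have h6 : stDefect m + (i + 1 : ℕ) = stDefect (m * 1) + 1 - 3 * 0 + i := by
      push_cast
      rw [mul_one]
      ring
    rw [h6]
    refine isClosed_closure.mem_of_tendsto h5 (h2.mono fun k hk => ?_)
    -- By induction δ_st(m3^k+1)+i lies in the closure for large k; let k → ∞.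
    have h7 := ih (m := 1 * (m * 3 ^ k + 1)) (by positivity) (by
      rw [hk.1, mul_one]
      convert hU using 1
      push_cast
      ring)
    rwa [hk.2] at h7

/-! ### Indices in well-ordered sets and blocks of type ω -/

theorem exists_strictMono_mem_of_isWF {A : Set ℝ} (hA : A.IsWF) (hinf : A.Infinite) :
    ∃ x : ℕ → ℝ, StrictMono x ∧ ∀ i, x i ∈ A := by
  let e := hinf.natEmbedding A
  obtain ⟨g, hg | hg⟩ := exists_increasing_or_nonincreasing_subseq (· < ·)
    (fun i => (e i : ℝ))
  · exact ⟨fun i => e (g i), fun i j hij => hg i j hij, fun i => (e (g i)).2⟩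
  · exfalso
    refine Set.isWF_iff_no_descending_seq.1 hA (fun i => (e (g i) : ℝ)) (fun i j hij => ?_)
      (fun i => (e (g i)).2)
    refine lt_of_le_of_ne (not_lt.1 (hg i j hij)) fun h => ?_
    exact (g.strictMono hij).ne' (e.injective (Subtype.ext h))

theorem ordinal_le_of_strictMono {α β : Ordinal.{0}} (f : Set.Iio α → Ordinal.{0})
    (hf : StrictMono f) (h : ∀ a, f a < β) : α ≤ β := by
  by_contra hlt
  push Not at hlt
  let f' : Set.Iio α → Set.Iio α := fun a => ⟨f a, (h a).trans hlt⟩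
  have h1 : StrictMono f' := fun a b hab => hf hab
  have h2 : (⟨β, hlt⟩ : Set.Iio α) ≤ f' ⟨β, hlt⟩ := h1.le_apply
  exact absurd (h ⟨β, hlt⟩) (not_lt.2 h2)

theorem IsNth.le_of_le {S : Set ℝ} {α β : Ordinal.{0}} {x y : ℝ} (hx : IsNth S α x)
    (hy : IsNth S β y) (h : x ≤ y) : α ≤ β := by
  obtain ⟨-, -, ⟨e⟩⟩ := hx
  obtain ⟨-, -, ⟨e'⟩⟩ := hy
  refine ordinal_le_of_strictMono
    (fun a => (e'.symm ⟨e a, (e a).2.1, (e a).2.2.trans_le h⟩ : Ordinal.{0}))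
    (fun a b hab => ?_) fun a => (e'.symm _).2
  exact e'.symm.strictMono (show (e a : ℝ) < e b from e.strictMono hab)

theorem IsNth.lt_of_lt {S : Set ℝ} {α β : Ordinal.{0}} {x y : ℝ} (hx : IsNth S α x)
    (hy : IsNth S β y) (h : x < y) : α < β := by
  obtain ⟨-, hxS, ⟨e⟩⟩ := hx
  obtain ⟨-, -, ⟨e'⟩⟩ := hy
  refine lt_of_le_of_lt (ordinal_le_of_strictMono
    (fun a => (e'.symm ⟨e a, (e a).2.1, (e a).2.2.trans h⟩ : Ordinal.{0}))
    (fun a b hab => ?_) (β := e'.symm ⟨x, hxS, h⟩) fun a => ?_) (e'.symm ⟨x, hxS, h⟩).2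
  · exact e'.symm.strictMono (show (e a : ℝ) < e b from e.strictMono hab)
  · exact e'.symm.strictMono (show (e a : ℝ) < x from (e a).2.2)

theorem IsNth.lt_of_index_lt {S : Set ℝ} {α β : Ordinal.{0}} {x y : ℝ} (hx : IsNth S α x)
    (hy : IsNth S β y) (h : α < β) : x < y := by
  by_contra hle
  exact absurd h (not_lt.2 (hy.le_of_le hx (not_lt.1 hle)))

theorem IsNth.eq {S : Set ℝ} {α : Ordinal.{0}} {x y : ℝ} (hx : IsNth S α x)
    (hy : IsNth S α y) : x = y :=
  le_antisymm (not_lt.1 fun h => lt_irrefl _ (hy.lt_of_lt hx h))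
    (not_lt.1 fun h => lt_irrefl _ (hx.lt_of_lt hy h))

theorem isNth_of_range_eq {S : Set ℝ} (hS : S.IsWF) {α : Ordinal.{0}} {x : ℝ} (hx : x ∈ S)
    (g : Set.Iio α → ℝ) (hg : StrictMono g) (hr : Set.range g = S ∩ Set.Iio x) :
    IsNth S α x :=
  ⟨hS, hx, ⟨(hg.orderIso g).trans (OrderIso.setCongr _ _ hr)⟩⟩

theorem IsNth.exists_isNth_of_lt {S : Set ℝ} {α γ : Ordinal.{0}} {x : ℝ} (hx : IsNth S α x)
    (h : γ < α) : ∃ y, y < x ∧ IsNth S γ y := by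
  obtain ⟨hS, hxS, ⟨e⟩⟩ := hx
  refine ⟨e ⟨γ, h⟩, (e ⟨γ, h⟩).2.2, isNth_of_range_eq hS (e ⟨γ, h⟩).2.1
    (fun a => e ⟨a, a.2.trans h⟩) (fun a b hab => e.strictMono (show a.1 < b.1 from hab)) ?_⟩
  ext y
  constructor
  · rintro ⟨a, rfl⟩
    exact ⟨(e _).2.1, e.strictMono (show a.1 < γ from a.2)⟩
  · rintro ⟨hy, hyx⟩
    have hy' : y ∈ S ∩ Set.Iio x := ⟨hy, (Set.mem_Iio.1 hyx).trans (e ⟨γ, h⟩).2.2⟩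
    have h1 : (e.symm ⟨y, hy'⟩ : Ordinal.{0}) < γ := by
      have : e.symm ⟨y, hy'⟩ < ⟨γ, h⟩ := by
        rw [e.symm_apply_lt]
        exact hyx
      exact this
    refine ⟨⟨_, h1⟩, ?_⟩
    have h2 : e (e.symm ⟨y, hy'⟩) = ⟨y, hy'⟩ := e.apply_symm_apply _
    exact congrArg Subtype.val h2

theorem exists_isNth {S : Set ℝ} (hS : S.IsWF) {x : ℝ} (hx : x ∈ S) : ∃ α, IsNth S α x := by
  have hA : (S ∩ Set.Iio x).IsWF := hS.mono Set.inter_subset_left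
  have : WellFoundedLT ↥(S ∩ Set.Iio x) := ⟨hA⟩
  exact ⟨_, hS, hx, ⟨OrderIso.ofRelIsoLT
    (Ordinal.enum (fun a b : ↥(S ∩ Set.Iio x) => a < b))⟩⟩

theorem isNth_of_forall {T : Set ℝ} (hT : T.IsWF) {β : Ordinal.{0}} {x : ℝ} (hx : x ∈ T)
    (h1 : ∀ t ∈ T, t < x → ∃ γ < β, IsNth T γ t) (h2 : ∀ γ < β, ∃ t < x, IsNth T γ t) :
    IsNth T β x := by
  choose g hgx hg using h2
  refine isNth_of_range_eq hT hx (fun γ => g γ.1 γ.2)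
    (fun a b hab => (hg _ a.2).lt_of_index_lt (hg _ b.2) hab) ?_
  ext t
  constructor
  · rintro ⟨a, rfl⟩
    exact ⟨(hg _ _).2.1, hgx _ _⟩
  · rintro ⟨ht, htx⟩
    obtain ⟨γ, hγ, hn⟩ := h1 t ht htx
    exact ⟨⟨γ, hγ⟩, (hg γ hγ).eq hn⟩

/-- The elements of `T` below `y + 1` and not below `z + 1` for any element `z < y` of `S`. -/
def shiftBlock (S T : Set ℝ) (y : ℝ) : Set ℝ :=
  {t : ℝ | t ∈ T ∧ t < y + 1 ∧ ∀ z ∈ S, z < y → z + 1 ≤ t}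

theorem exists_mem_shiftBlock {S T : Set ℝ} (hS : S.IsWF) {y t : ℝ} (hy : y ∈ S) (ht : t ∈ T)
    (hty : t < y + 1) : ∃ z ∈ S, z ≤ y ∧ t ∈ shiftBlock S T z := by
  have hA : (S ∩ {z | t < z + 1}).IsWF := hS.mono Set.inter_subset_left
  have hne : (S ∩ {z | t < z + 1}).Nonempty := ⟨y, hy, hty⟩
  have hmem := hA.min_mem hne
  -- The block containing t belongs to the least z in S with t < z+1.
  refine ⟨hA.min hne, hmem.1, hA.min_le hne ⟨hy, hty⟩, ht, hmem.2, fun z hz hlt => ?_⟩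
  by_contra hcon
  exact absurd (hA.min_le hne ⟨hz, not_le.1 hcon⟩) (not_le.2 hlt)

theorem exists_ncard_eq_of_isWF {A : Set ℝ} (hA : A.IsWF) (hinf : A.Infinite)
    (hfin : ∀ t ∈ A, (A ∩ Set.Iio t).Finite) (k : ℕ) :
    ∃ t ∈ A, (A ∩ Set.Iio t).ncard = k := by
  induction k with
  | zero =>
    refine ⟨hA.min hinf.nonempty, hA.min_mem _, ?_⟩
    rw [Set.ncard_eq_zero (hfin _ (hA.min_mem _))]
    ext t
    simp only [Set.mem_inter_iff, Set.mem_Iio, Set.mem_empty_iff_false, iff_false, not_and]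
    exact fun ht => not_lt.2 (hA.min_le _ ht)
  | succ k ih =>
    obtain ⟨t, ht, hk⟩ := ih
    have hB : (A ∩ Set.Ioi t).IsWF := hA.mono Set.inter_subset_left
    have hne : (A ∩ Set.Ioi t).Nonempty := by
      by_contra hcon
      refine hinf (((hfin t ht).insert t).subset fun s hs => ?_)
      rcases lt_trichotomy s t with h | h | h
      · exact Or.inr ⟨hs, h⟩
      · exact Or.inl h
      · exact absurd ⟨s, hs, h⟩ hcon
    have hmem := hB.min_mem hne
    refine ⟨hB.min hne, hmem.1, ?_⟩
    have h : A ∩ Set.Iio (hB.min hne) = insert t (A ∩ Set.Iio t) := by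
      ext s
      constructor
      · rintro ⟨hs, hlt⟩
        rcases lt_trichotomy s t with h | h | h
        · exact Or.inr ⟨hs, h⟩
        · exact Or.inl h
        · exact absurd (hB.min_le hne ⟨hs, h⟩) (not_le.2 hlt)
      · rintro (rfl | ⟨hs, hlt⟩)
        · exact ⟨ht, hmem.2⟩
        · exact ⟨hs, (Set.mem_Iio.1 hlt).trans hmem.2⟩
    rw [h, Set.ncard_insert_of_notMem (by simp) (hfin t ht), hk]

/-- Both sets are well-ordered, and the blocks of `T` have order type `ω`. -/
structure HasOmegaBlocks (S T : Set ℝ) : Prop where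
  left_isWF : S.IsWF
  right_isWF : T.IsWF
  infinite : ∀ y ∈ S, (shiftBlock S T y).Infinite
  finite : ∀ y ∈ S, ∀ t < y + 1, (shiftBlock S T y ∩ Set.Iio t).Finite

namespace HasOmegaBlocks

variable {S T : Set ℝ}

/-- Well-founded induction on t: the elements below t are those of earlier blocks, which take up
exactly the indices below ωα, and the finitely many earlier ones of its own block. -/
theorem isNth_of_mem_shiftBlock (H : HasOmegaBlocks S T) {t : ℝ} (htT : t ∈ T) :
    ∀ {α : Ordinal.{0}} {y : ℝ}, IsNth S α y → t ∈ shiftBlock S T y →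
    IsNth T (ω * α + ((shiftBlock S T y ∩ Set.Iio t).ncard : Ordinal.{0})) t := by
  obtain ⟨hS, hT, hinf, hfin⟩ := H
  refine Set.WellFoundedOn.induction (P := fun t => ∀ {α : Ordinal.{0}} {y : ℝ},
    IsNth S α y → t ∈ shiftBlock S T y →
    IsNth T (ω * α + ((shiftBlock S T y ∩ Set.Iio t).ncard : Ordinal.{0})) t) hT htT
    fun t htT ih => ?_
  intro α y hα ht
  have hy := hα.2.1
  have hblock : ∀ z ∈ S, ∀ k : ℕ, ∃ s ∈ shiftBlock S T z,
      (shiftBlock S T z ∩ Set.Iio s).ncard = k := fun z hz k =>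
    exists_ncard_eq_of_isWF (hT.mono fun s hs => hs.1) (hinf z hz)
      (fun s hs => hfin z hz s hs.2.1) k
  refine isNth_of_forall hT htT (fun s hs hst => ?_) fun γ hγ => ?_
  · obtain ⟨z, hz, hzy, hsz⟩ := exists_mem_shiftBlock hS hy hs (hst.trans ht.2.1)
    obtain ⟨α', hα'⟩ := exists_isNth hS hz
    refine ⟨_, ?_, ih s hs hst hα' hsz⟩
    rcases hzy.lt_or_eq with h | rfl
    · calc ω * α' + ((shiftBlock S T z ∩ Set.Iio s).ncard : Ordinal.{0}) < ω * α' + ω := by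
            gcongr
            exact Ordinal.natCast_lt_omega0 _
        _ = ω * Order.succ α' := (Ordinal.mul_succ _ _).symm
        _ ≤ ω * α := by
            gcongr
            exact Order.succ_le_of_lt (hα'.lt_of_lt hα h)
        _ ≤ _ := le_self_add
    · obtain rfl : α' = α := le_antisymm (hα'.le_of_le hα le_rfl) (hα.le_of_le hα' le_rfl)
      gcongr
      refine Set.ncard_lt_ncard ⟨fun r hr => ⟨hr.1, lt_trans hr.2 hst⟩, fun h => ?_⟩
        (hfin z hz t ht.2.1)
      exact lt_irrefl s (h ⟨hsz, hst⟩).2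
  · rcases lt_or_ge γ (ω * α) with h | h
    · have h1 : γ / ω < α := (Ordinal.lt_mul_iff_div_lt Ordinal.omega0_ne_zero).1 h
      obtain ⟨k, hk⟩ := Ordinal.lt_omega0.1 (Ordinal.mod_lt γ Ordinal.omega0_ne_zero)
      obtain ⟨z, hzy, hz⟩ := hα.exists_isNth_of_lt h1
      obtain ⟨s, hs, hsk⟩ := hblock z hz.2.1 k
      have hst : s < t := hs.2.1.trans_le (ht.2.2 z hz.2.1 hzy)
      have := ih s hs.1 hst hz hs
      rw [hsk, ← hk, Ordinal.div_add_mod] at this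
      exact ⟨s, hst, this⟩
    · obtain ⟨j, hj⟩ := Ordinal.lt_omega0.1
        (((Ordinal.sub_lt_of_le h).2 hγ).trans (Ordinal.natCast_lt_omega0 _))
      have hγ' : γ = ω * α + j := by rw [← hj, Ordinal.add_sub_cancel_of_le h]
      obtain ⟨s, hs, hsj⟩ := hblock y hy j
      have hst : s < t := by
        by_contra hcon
        have h1 := Set.ncard_le_ncard (s := shiftBlock S T y ∩ Set.Iio t)
          (t := shiftBlock S T y ∩ Set.Iio s)
          (fun r hr => ⟨hr.1, lt_of_lt_of_le hr.2 (not_lt.1 hcon)⟩) (hfin y hy s hs.2.1)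
        rw [hγ'] at hγ
        have h2 := lt_of_add_lt_add_left hγ
        rw [Nat.cast_lt] at h2
        omega
      have := ih s hs.1 hst hα hs
      rw [hsj, ← hγ'] at this
      exact ⟨s, hst, this⟩

theorem exists_mem_shiftBlock_isNth (H : HasOmegaBlocks S T) {α : Ordinal.{0}} {y : ℝ} (hα : IsNth S α y) (k : ℕ) :
    ∃ t ∈ shiftBlock S T y, IsNth T (ω * α + (k : Ordinal.{0})) t := by
  obtain ⟨t, ht, rfl⟩ := exists_ncard_eq_of_isWF (H.right_isWF.mono fun s hs => hs.1) (H.infinite y hα.2.1)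
    (fun s hs => H.finite y hα.2.1 s hs.2.1) k
  exact ⟨t, ht, H.isNth_of_mem_shiftBlock ht.1 hα ht⟩

theorem omegaBlock_eq_shiftBlock (H : HasOmegaBlocks S T) {α : Ordinal.{0}} {y : ℝ} (hα : IsNth S α y) :
    omegaBlock T α = shiftBlock S T y := by
  ext x
  constructor
  · rintro ⟨k, hk⟩
    obtain ⟨t, ht, htk⟩ := H.exists_mem_shiftBlock_isNth hα k
    exact hk.eq htk ▸ ht
  · exact fun hx => ⟨_, H.isNth_of_mem_shiftBlock hx.1 hα hx⟩

theorem shiftBlock_eq_inter_Ico (H : HasOmegaBlocks S T) {α : Ordinal.{0}} {y x₀ : ℝ} (hα : IsNth S α y)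
    (hx₀ : IsNth T (ω * α) x₀) : shiftBlock S T y = T ∩ Set.Ico x₀ (y + 1) := by
  obtain ⟨t, ht, ht0⟩ := H.exists_mem_shiftBlock_isNth hα 0
  rw [Nat.cast_zero, add_zero] at ht0
  obtain rfl := hx₀.eq ht0
  ext s
  constructor
  · intro hs
    refine ⟨hs.1, ?_, hs.2.1⟩
    by_contra hcon
    have := (H.isNth_of_mem_shiftBlock hs.1 hα hs).lt_of_lt hx₀ (not_le.1 hcon)
    exact absurd this (not_lt.2 le_self_add)
  · rintro ⟨hs, h1, h2⟩
    exact ⟨hs, h2, fun z hz hzy => (ht.2.2 z hz hzy).trans h1⟩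

end HasOmegaBlocks

/-! ### The blocks of the stable defects -/

/-- The limit is δ_st(m)+d+1 with d ≥ 0, and the class of ‖m‖_st + d lies in U, so δ_st(m)+d is in
the closure by `stDefect_add_mem_closure`. -/
theorem sub_one_mem_closure_of_tendsto {U U' : Set (ZMod 3)} (hU : ∀ v, v ∈ U ↔ v + 1 ∈ U')
    {x : ℕ → ℝ} (hx : StrictMono x) (hmem : ∀ i, x i ∈ stDefectsIn U') {L : ℝ}
    (hL : Tendsto x atTop (𝓝 L)) : L - 1 ∈ closure (stDefectsIn U) := by
  choose n hn hnU hxn using hmem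
  obtain rfl : x = stDefect ∘ n := funext hxn
  obtain ⟨m, j, hm, hj, rfl, ⟨i, hi⟩, -⟩ := exists_of_strictMono_stDefect hn hx hL
  obtain ⟨d, rfl⟩ : ∃ d : ℕ, j = d + 1 := ⟨(j - 1).toNat, by omega⟩
  have h := stDefect_add_mem_closure d hm (U := U) (by
    rw [hU]
    have := hnU i
    rw [hi] at this
    push_cast at this
    rwa [← add_assoc] at this)
  convert h using 1
  push_cast
  ring

/-- A stable defect is not a limit of smaller stable defects. -/
theorem exists_lt_forall_le_of_stDefect {n : ℕ} (hn : 0 < n) (U : Set (ZMod 3)) :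
    ∃ t < stDefect n, ∀ z ∈ stDefectsIn U, z < stDefect n → z ≤ t := by
  by_contra! hcon
  have hlub : IsLUB (stDefectsIn U ∩ Set.Iio (stDefect n)) (stDefect n) := by
    refine ⟨fun z hz => le_of_lt hz.2, fun t ht => ?_⟩
    by_contra hlt
    obtain ⟨z, hz, hzn, htz⟩ := hcon t (not_le.1 hlt)
    exact absurd (ht ⟨hz, hzn⟩) (not_le.2 htz)
  obtain ⟨z, hz, hzn, -⟩ := hcon (stDefect n - 1) (by linarith)
  obtain ⟨x, hx, -, hL, hmem⟩ :=
    hlub.exists_seq_strictMono_tendsto_of_notMem (fun h => lt_irrefl (stDefect n) h.2) ⟨z, hz, hzn⟩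
  choose k hk _ hxk using fun i => (hmem i).1
  obtain rfl : x = stDefect ∘ k := funext hxk
  exact not_tendsto_stDefect_of_strictMono hk hx hn (d := 0) (by simpa using hL)

theorem eventually_mem_shiftBlock {U U' : Set (ZMod 3)} (hU : ∀ v, v ∈ U ↔ v + 1 ∈ U')
    {a b : ℕ} (ha : 0 < a) (hb : 0 < b) (hab : stCpx (a * b) = stCpx a + stCpx b)
    (hmem : stDefect (a * b) ∈ stDefectsIn U) :
    ∀ᶠ k : ℕ in atTop, stDefect (b * (a * 3 ^ k + 1)) ∈
      shiftBlock (stDefectsIn U) (stDefectsIn U') (stDefect (a * b)) := by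
  have hpos : 0 < a * b := by positivity
  -- The elements of the lower set below δ_st(ab) stay at or below some t < δ_st(ab), so exceeding
  -- t+1 suffices for the lower bound of the block.
  obtain ⟨t, ht, hle⟩ := exists_lt_forall_le_of_stDefect hpos U
  filter_upwards [eventually_stDefect_linear ha hb hab,
    eventually_stDefect_linear_mem_Ioo ha hb hab (t := t + 1) (by linarith)] with k h1 h2
  refine ⟨?_, h2.2, fun z hz hzn => ?_⟩
  · rw [stDefect_mem_stDefectsIn (by positivity), h1.1, ← hU]
    rwa [stDefect_mem_stDefectsIn hpos] at hmem
  · have := hle z hz hzn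
    linarith [h2.1]

theorem exists_tendsto_of_mem_shiftBlock {S T : Set ℝ} {y : ℝ} {x : ℕ → ℝ} (hx : StrictMono x)
    (hmem : ∀ i, x i ∈ shiftBlock S T y) : ∃ L, Tendsto x atTop (𝓝 L) ∧ ∀ i, x i < L := by
  have hL := tendsto_atTop_ciSup hx.monotone
    ⟨y + 1, by rintro _ ⟨i, rfl⟩; exact (hmem i).2.1.le⟩
  exact ⟨_, hL, fun i => (hx i.lt_succ_self).trans_le (hx.monotone.ge_of_tendsto hL _)⟩

theorem hasOmegaBlocks_stDefectsIn {U U' : Set (ZMod 3)} (hU : ∀ v, v ∈ U ↔ v + 1 ∈ U') :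
    HasOmegaBlocks (stDefectsIn U) (stDefectsIn U') where
  left_isWF := stDefectsIn_isWF U
  right_isWF := stDefectsIn_isWF U'
  infinite := by
    rintro _ ⟨n, hn, hnU, rfl⟩ hfin
    have h1 : stCpx (n * 1) = stCpx n + stCpx 1 := by simp [stCpx_one]
    have hmem : stDefect (n * 1) ∈ stDefectsIn U := by
      rw [mul_one]
      exact ⟨n, hn, hnU, rfl⟩
    have h2 := eventually_mem_shiftBlock hU hn one_pos h1 hmem
    rw [mul_one] at h2
    -- A finite block would have a maximum, which δ_st(n3^k+1) eventually exceeds.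
    obtain ⟨t, ht, hmax⟩ := Set.exists_max_image _ id hfin ⟨_, h2.exists.choose_spec⟩
    have h3 := eventually_stDefect_linear_mem_Ioo hn one_pos h1 (t := t) (by
      rw [mul_one]
      exact ht.2.1)
    obtain ⟨k, hk, hk'⟩ := (h2.and h3).exists
    exact absurd hk'.1 (not_lt.2 (hmax _ hk))
  finite := by
    intro y hy t ht
    by_contra hinf
    obtain ⟨x, hx, hmem⟩ := exists_strictMono_mem_of_isWF
      ((stDefectsIn_isWF U').mono fun s hs => hs.1.1) hinf
    obtain ⟨L, hL, hxL⟩ := exists_tendsto_of_mem_shiftBlock hx fun i => (hmem i).1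
    have hLt : L ≤ t := le_of_tendsto' hL fun i => (hmem i).2.le
    have hcl := sub_one_mem_closure_of_tendsto hU hx (fun i => (hmem i).1.1) hL
    -- Such a w < y lies in the lower set, so the block condition gives w+1 ≤ x 0, contrary to w > x
    -- 0 - 1.
    obtain ⟨w, hw, hwS⟩ := mem_closure_iff.1 hcl (Set.Ioo (x 0 - 1) y) isOpen_Ioo
      ⟨by linarith [hxL 0], by linarith⟩
    have := (hmem 0).1.2.2 w hwS hw.2
    linarith [hw.1]

theorem eq_of_three_pow_mul_eq {n m p q : ℕ} (hn : ¬ 3 ∣ n) (hm : ¬ 3 ∣ m)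
    (h : 3 ^ p * n = 3 ^ q * m) : n = m := by
  have hc : ∀ x, ¬ 3 ∣ x → ∀ e, Nat.Coprime x (3 ^ e) := fun x hx e =>
    (((Nat.Prime.coprime_iff_not_dvd Nat.prime_three).2 hx).symm).pow_right e
  exact Nat.dvd_antisymm
    ((hc n hn q).dvd_of_dvd_mul_left (h ▸ Dvd.intro_left _ rfl))
    ((hc m hm p).dvd_of_dvd_mul_left (h ▸ Dvd.intro_left _ rfl))

theorem stDefect_mem_factorDefects {n a b p q : ℕ} (hn : ¬ 3 ∣ n) (ha : 0 < a) (hb : 0 < b)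
    (hab : stCpx (a * b) = stCpx a + stCpx b) (h : 3 ^ p * n = 3 ^ q * (a * b)) (k : ℕ) :
    stDefect (b * (a * 3 ^ k + 1)) ∈ factorDefects n := by
  obtain ⟨v, a', ha3, rfl⟩ := Nat.exists_eq_pow_mul_and_not_dvd ha.ne' 3 (by norm_num)
  obtain ⟨w, b', hb3, rfl⟩ := Nat.exists_eq_pow_mul_and_not_dvd hb.ne' 3 (by norm_num)
  have ha' : 0 < a' := Nat.pos_of_mul_pos_left ha
  have hb' : 0 < b' := Nat.pos_of_mul_pos_left hb
  have hn' : n = a' * b' := by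
    refine eq_of_three_pow_mul_eq (p := p) (q := q + v + w) hn ?_ (by rw [h]; ring)
    rw [Nat.prime_three.dvd_mul]
    tauto
  have h1 : 3 ^ v * a' * (3 ^ w * b') = 3 ^ (v + w) * (a' * b') := by ring
  rw [h1, stCpx_three_pow_mul (by positivity), stCpx_three_pow_mul ha', stCpx_three_pow_mul hb',
    ← hn'] at hab
  -- The power of 3 in a moves into the exponent k; the one in b does not affect the stable defect.
  refine ⟨a', b', k + v, hn'.symm, ?_, ?_⟩
  · push_cast at hab
    omega
  · rw [← stDefect_three_pow_mul (n := b' * (a' * 3 ^ (k + v) + 1)) (by positivity) w]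
    congr 1
    ring

theorem finite_symmDiff_shiftBlock_factorDefects {U U' : Set (ZMod 3)}
    (hU : ∀ v, v ∈ U ↔ v + 1 ∈ U') {n : ℕ} (hn : ¬ 3 ∣ n) (hmem : stDefect n ∈ stDefectsIn U) :
    (symmDiff (shiftBlock (stDefectsIn U) (stDefectsIn U') (stDefect n))
      (factorDefects n)).Finite := by
  have hn0 : 0 < n := Nat.pos_of_ne_zero fun h => hn (h ▸ dvd_zero 3)
  have H := hasOmegaBlocks_stDefectsIn hU
  refine Set.Finite.union ?_ ?_
  · by_contra hinf
    obtain ⟨x, hx, hxmem⟩ := exists_strictMono_mem_of_isWF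
      ((stDefectsIn_isWF U').mono fun s hs => hs.1.1) hinf
    obtain ⟨L, hL, hxL⟩ := exists_tendsto_of_mem_shiftBlock hx fun i => (hxmem i).1
    -- The block is finite below any smaller bound.
    have hLy : L = stDefect n + 1 := by
      refine le_antisymm (le_of_tendsto' hL fun i => (hxmem i).1.2.1.le) (not_lt.1 fun hlt => ?_)
      exact Set.infinite_of_injective_forall_mem hx.injective
        (fun i => (⟨(hxmem i).1, hxL i⟩ : x i ∈ _ ∩ Set.Iio L)) (H.finite _ hmem L hlt)
    choose k hk _ hxk using fun i => (hxmem i).1.1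
    obtain rfl : x = stDefect ∘ k := funext hxk
    obtain ⟨m, j, hm, hj, hLm, -, h1⟩ := exists_of_strictMono_stDefect hk hx hL
    -- The equality δ_st(n)+1 = δ_st(m)+j gives j = 1 and identifies m with n up to powers of 3.
    obtain ⟨hj1, p, q, hpq, -⟩ := exists_three_pow_mul_eq_of_stDefect (j := j - 1) hn0 hm
      (by push_cast; linarith)
    obtain ⟨i, a, b, l, ha, hb, rfl, hab, hi⟩ := h1 (by omega)
    refine (hxmem i).2 ?_
    simp only [Function.comp]
    rw [hi]
    exact stDefect_mem_factorDefects hn ha hb hab hpq l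
  · have hfin : ∀ p : ℕ × ℕ, p.1 * p.2 = n → stCpx n = stCpx p.1 + stCpx p.2 →
        {k : ℕ | stDefect (p.2 * (p.1 * 3 ^ k + 1)) ∉
          shiftBlock (stDefectsIn U) (stDefectsIn U') (stDefect n)}.Finite := by
      rintro ⟨a, b⟩ rfl hab
      have h := eventually_mem_shiftBlock hU (Nat.pos_of_mul_pos_right hn0)
        (Nat.pos_of_mul_pos_left hn0) hab hmem
      rw [← Nat.cofinite_eq_atTop] at h
      exact h
    have hfin' : ∀ p ∈ {p : ℕ × ℕ | p ∈ n.divisorsAntidiagonal ∧ stCpx n = stCpx p.1 + stCpx p.2},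
        ((fun k => stDefect (p.2 * (p.1 * 3 ^ k + 1))) ''
        {k : ℕ | stDefect (p.2 * (p.1 * 3 ^ k + 1)) ∉
          shiftBlock (stDefectsIn U) (stDefectsIn U') (stDefect n)}).Finite := fun p hp =>
      (hfin p (Nat.mem_divisorsAntidiagonal.1 hp.1).1 hp.2).image _
    refine (Set.Finite.biUnion (n.divisorsAntidiagonal.finite_toSet.subset fun p hp => hp.1)
      hfin').subset ?_
    rintro _ ⟨⟨a, b, k, hab, hst, rfl⟩, hnot⟩
    exact Set.mem_biUnion (x := (a, b)) ⟨Nat.mem_divisorsAntidiagonal.2 ⟨hab, hn0.ne'⟩, hst⟩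
      ⟨k, hnot, rfl⟩

/-- The order structure of the stable defects around `δ_st(n) + 1`. -/
theorem omegaBlock_stDefectsIn {U U' : Set (ZMod 3)} (hU : ∀ v, v ∈ U ↔ v + 1 ∈ U') {n : ℕ}
    (hn : ¬ 3 ∣ n) (hnU : (stCpx n : ZMod 3) ∈ U) :
    (∃ α : Ordinal.{0}, IsNth (stDefectsIn U) α (stDefect n)) ∧
      ∀ α : Ordinal.{0}, IsNth (stDefectsIn U) α (stDefect n) →
        (∀ k : ℕ, ∃ x : ℝ, IsNth (stDefectsIn U') (ω * α + (k : Ordinal.{0})) x) ∧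
        (∀ x₀ : ℝ, IsNth (stDefectsIn U') (ω * α) x₀ →
          omegaBlock (stDefectsIn U') α =
            stDefectsIn U' ∩ Set.Ico x₀ (stDefect n + 1)) ∧
        (symmDiff (omegaBlock (stDefectsIn U') α) (factorDefects n)).Finite := by
  have hn0 : 0 < n := Nat.pos_of_ne_zero fun h => hn (h ▸ dvd_zero 3)
  have H := hasOmegaBlocks_stDefectsIn hU
  have hmem := (stDefect_mem_stDefectsIn hn0).2 hnU
  refine ⟨exists_isNth H.left_isWF hmem, fun α hα => ⟨fun k => ?_, fun x₀ hx₀ => ?_, ?_⟩⟩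
  · obtain ⟨t, -, ht⟩ := H.exists_mem_shiftBlock_isNth hα k
    exact ⟨t, ht⟩
  · rw [H.omegaBlock_eq_shiftBlock hα, H.shiftBlock_eq_inter_Ico hα hx₀]
  · rw [H.omegaBlock_eq_shiftBlock hα]
    exact finite_symmDiff_shiftBlock_factorDefects hU hn hmem

end IntegerComplexity
theorem mainTheorem7 (n : ℕ) (hn : ¬ 3 ∣ n) (u : ZMod 3)
    (hu : (IntegerComplexity.stCpx n : ZMod 3) = u) :
    ((∃ α : Ordinal.{0}, IntegerComplexity.IsNth (IntegerComplexity.stDefectsMod u) α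
        (IntegerComplexity.stDefect n)) ∧
      ∀ α : Ordinal.{0}, IntegerComplexity.IsNth (IntegerComplexity.stDefectsMod u) α
          (IntegerComplexity.stDefect n) →
        (∀ k : ℕ, ∃ x : ℝ, IntegerComplexity.IsNth (IntegerComplexity.stDefectsMod (u + 1))
          (ω * α + (k : Ordinal.{0})) x) ∧
        (∀ x₀ : ℝ, IntegerComplexity.IsNth (IntegerComplexity.stDefectsMod (u + 1)) (ω * α) x₀ →
          IntegerComplexity.omegaBlock (IntegerComplexity.stDefectsMod (u + 1)) α =
            IntegerComplexity.stDefectsMod (u + 1) ∩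
              Set.Ico x₀ (IntegerComplexity.stDefect n + 1)) ∧
        (symmDiff (IntegerComplexity.omegaBlock (IntegerComplexity.stDefectsMod (u + 1)) α)
          (IntegerComplexity.factorDefects n)).Finite) ∧
    ((∃ α : Ordinal.{0}, IntegerComplexity.IsNth IntegerComplexity.stDefects α
        (IntegerComplexity.stDefect n)) ∧
      ∀ α : Ordinal.{0}, IntegerComplexity.IsNth IntegerComplexity.stDefects α
          (IntegerComplexity.stDefect n) →
        (∀ k : ℕ, ∃ x : ℝ, IntegerComplexity.IsNth IntegerComplexity.stDefects
          (ω * α + (k : Ordinal.{0})) x) ∧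
        (∀ x₀ : ℝ, IntegerComplexity.IsNth IntegerComplexity.stDefects (ω * α) x₀ →
          IntegerComplexity.omegaBlock IntegerComplexity.stDefects α =
            IntegerComplexity.stDefects ∩ Set.Ico x₀ (IntegerComplexity.stDefect n + 1)) ∧
        (symmDiff (IntegerComplexity.omegaBlock IntegerComplexity.stDefects α)
          (IntegerComplexity.factorDefects n)).Finite) := by
  -- Both parts are instances of one statement: a single class and its successor, or all classes,
  -- which are invariant under the shift.
  have h1 := IntegerComplexity.omegaBlock_stDefectsIn (U := {u}) (U' := {u + 1})
    (fun v => by simp) hn hu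
  have h2 := IntegerComplexity.omegaBlock_stDefectsIn (U := Set.univ) (U' := Set.univ)
    (fun v => by simp) hn trivial
  rw [← IntegerComplexity.stDefectsMod_eq, ← IntegerComplexity.stDefectsMod_eq] at h1
  rw [← IntegerComplexity.stDefects_eq] at h2
  exact ⟨h1, h2⟩
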